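/- **Proposition 2.1 (An elliptic identity for zero mean curvature submanifolds).** Let $(\hat M,\hat g)$ be a smooth pseudo-Riemannian manifold of dimension $n+m$ and signature $(n,m)$ ($n$ positive and $m$ negative directions), with Levi-Civita connection $\hat D$ and Riemann curvature tensor $$\hat R(X,Y,Z,W)=-\hat g(\hat D_X\hat D_YZ-\hat D_Y\hat D_XZ-\hat D_{[X,Y]}Z,\,W).$$ Let $M$ be an $n$-dimensional smooth manifold, immersed in $\hat M$ by a smooth map such that the restriction (pullback) $g$ of $\hat g$ to $M$ is positive definite (in particular, $M$ may be a spacelike submanifold of $\hat M$). Let $D$ be the Levi-Civita connection of $(M,g)$, and let $I\!I(X,Y)=\hat D_XY-D_XY$ be the second fundamental form; assume that its trace with respect to $g$ vanishes identically. Let $\hat S$ be a smooth symmetric $(0,2)$-tensor field on $\hat M$ and let $S$ be its restriction to $M$. Write $\hat D^2_{V,W}\hat S=\hat D_V\hat D_W\hat S-\hat D_{\hat D_VW}\hat S$, and let $\Delta S$ be the trace with respect to $g$ of the second covariant derivative $D^2S$. Fix a point $p\in M$. Let $\hat E_1,\dots,\hat E_{n+m}$ be a basis of the tangent space of $\hat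 M$ at $p$, let $\hat\sigma^{\alpha\beta}$ be the entries of the inverse of the matrix $\hat g(\hat E_\alpha,\hat E_\beta)$, let $e_1,\dots,e_n$ be a $g$-orthonormal basis of $T_pM$, and let $X,Y\in T_pM$ (for instance, the values at $p$ of a local frame on $\hat M$, of a local orthonormal frame on $M$ and of two vector fields on $M$). Then, at $p$, $$\begin{aligned} (\Delta S)(X,Y) &= \sum_{l=1}^n (\hat D^2_{e_l,e_l}\hat S)(X,Y) + 2\sum_{l=1}^n (\hat D_{e_l}\hat S)(I\!I(e_l,X),Y) + 2\sum_{l=1}^n (\hat D_{e_l}\hat S)(X,I\!I(e_l,Y)) \\ &\quad + 2\sum_{l=1}^n \hat S(I\!I(e_l,X),I\!I(e_l,Y)) \\ &\quad - \sum_{k,l=1}^n \hat g(I\!I(e_l,X),I\!I(e_l,e_k))\,S(e_k,Y) - \sum_{k,l=1}^n \hat g(I\!I(e_l,Y),I\!I(e_l,e_k))\,S(X,e_k) \\ &\quad - \sum_{\alpha,\beta=1}^{n+m}\sum_{l=1}^n \hat\sigma^{\alpha\beta}\,\hat R(e_l,X,e_l,\hat E_\alpha)\,\hat S(\hat E_\beta,Y)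 - \sum_{\alpha,\beta=1}^{n+m}\sum_{l=1}^n \hat\sigma^{\alpha\beta}\,\hat R(e_l,Y,e_l,\hat E_\alpha)\,\hat S(X,\hat E_\beta) \\ &\quad + \sum_{k,l=1}^n \hat R(e_l,X,e_l,e_k)\,S(e_k,Y) + \sum_{k,l=1}^n \hat R(e_l,Y,e_l,e_k)\,S(X,e_k). \end{aligned}$$ -/

import Mathlib

open scoped Manifold ContDiff Topology

noncomputable section

namespace SpacelikeGeometry

variable {E : Type*} [NormedAddCommGroup E] [NormedSpace ℝ E]
  {H : Type*} [TopologicalSpace H] {I : ModelWithCorners ℝ E H}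
  {M : Type*} [TopologicalSpace M] [ChartedSpace H M]

/-! ### Fields of bilinear forms -/

variable (I M) in
/-- A `(0,2)`-tensor field on `M` (no regularity is built in). -/
abbrev FormField : Type _ := Π x : M, TangentSpace I x →L[ℝ] TangentSpace I x →L[ℝ] ℝ

/-- The bilinear form `(v, w) ↦ B (A v) (A w)`. -/
def pullbackForm {V W : Type*} [AddCommGroup V] [Module ℝ V] [TopologicalSpace V]
    [IsTopologicalAddGroup V] [ContinuousSMul ℝ V]
    [AddCommGroup W] [Module ℝ W] [TopologicalSpace W]
    [IsTopologicalAddGroup W] [ContinuousSMul ℝ W]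
    (B : V →L[ℝ] V →L[ℝ] ℝ) (A : W →L[ℝ] V) : W →L[ℝ] W →L[ℝ] ℝ :=
  (A.precomp ℝ) ∘L B ∘L A

lemma pullbackForm_apply {V W : Type*} [AddCommGroup V] [Module ℝ V] [TopologicalSpace V]
    [IsTopologicalAddGroup V] [ContinuousSMul ℝ V]
    [AddCommGroup W] [Module ℝ W] [TopologicalSpace W]
    [IsTopologicalAddGroup W] [ContinuousSMul ℝ W]
    (B : V →L[ℝ] V →L[ℝ] ℝ) (A : W →L[ℝ] V) (v w : W) :
    pullbackForm B A v w = B (A v) (A w) := rfl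

instance (x : M) [FiniteDimensional ℝ E] : FiniteDimensional ℝ (TangentSpace I x) :=
  inferInstanceAs (FiniteDimensional ℝ E)

/-- The trace `∑ g^{ij} B(b_i, b_j)` of a bilinear map `B` with respect to a nondegenerate
bilinear form `g`, where `(b_i)` is a basis and `g^{ij}` is the inverse of the matrix
`g(b_i, b_j)`; for bilinear `B` it does not depend on the basis. -/
def metricTrace {V W : Type*} [AddCommGroup V] [Module ℝ V] [TopologicalSpace V]
    [IsTopologicalAddGroup V] [ContinuousSMul ℝ V] [FiniteDimensional ℝ V]
    [AddCommGroup W] [Module ℝ W] (g : V →L[ℝ] V →L[ℝ] ℝ) (B : V → V → W) : W :=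
  let b := Module.finBasis ℝ V
  ∑ i, ∑ j, (Matrix.of fun i j ↦ g (b i) (b j))⁻¹ i j • B (b i) (b j)

/-! ### The Levi-Civita connection

It is built in the preferred chart at each point: `(D_v Y)(x)` is the derivative of the components
of `Y` plus the vector dual to the Koszul form `w ↦ ½ (∂_v g(Y,w) + ∂_Y g(v,w) - ∂_w g(v,Y))`,
that is the Christoffel term. Afterwards it is shown to be torsion-free and metric. -/

section Connection

lemma mvfderiv_congr {F : Type*} [NormedAddCommGroup F] [NormedSpace ℝ F] {f f' : M → F} {x : M}
    (h : f =ᶠ[𝓝 x] f') : d% f x = d% f' x := by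
  rw [mvfderiv, h.mfderiv_eq, mvfderiv, h.self_of_nhds]

lemma mvfderiv_clm_apply {F F' : Type*} [NormedAddCommGroup F] [NormedSpace ℝ F]
    [NormedAddCommGroup F'] [NormedSpace ℝ F'] {f : M → F →L[ℝ] F'} {y : M → F} {x : M}
    (hf : MDiffAt f x) (hy : MDiffAt y x) (v : TangentSpace I x) :
    d% (fun q ↦ f q (y q)) x v = d% f x v (y x) + f x (d% y x v) := by
  have hfy : MDiffAt (fun q ↦ f q (y q)) x := hf.clm_apply hy
  have hu : UniqueDiffWithinAt ℝ (Set.range I) (extChartAt I x x) :=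
    I.uniqueDiffOn _ (Set.mem_range_self _)
  have hf' : DifferentiableWithinAt ℝ (f ∘ (extChartAt I x).symm) (Set.range I)
      (extChartAt I x x) := by
    exact ((mdifferentiableAt_iff _ _).1 hf).2
  have hy' : DifferentiableWithinAt ℝ (y ∘ (extChartAt I x).symm) (Set.range I)
      (extChartAt I x x) := by
    exact ((mdifferentiableAt_iff _ _).1 hy).2
  have h := congrArg (fun L ↦ L v) (fderivWithin_clm_apply hu hf' hy')
  simp only [mvfderiv, mfderiv, hf, hy, hfy]
  refine Eq.trans ?_ (h.trans ?_)
  · rfl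
  · simp only [Function.comp_apply, extChartAt_to_inv]
    exact add_comm _ _

variable [IsManifold I 1 M]

/-- Smoothness of a `(0,2)`-tensor field, as a section of the bundle of bilinear forms. -/
def IsSmooth (g : FormField I M) : Prop :=
  ContMDiff I (I.prod 𝓘(ℝ, E →L[ℝ] E →L[ℝ] ℝ)) ∞ fun x ↦
    (⟨x, g x⟩ : Bundle.TotalSpace (E →L[ℝ] E →L[ℝ] ℝ)
      fun x : M ↦ TangentSpace I x →L[ℝ] TangentSpace I x →L[ℝ] ℝ)

/-- A pseudo-Riemannian metric of signature `(n, m)`: a smooth field of symmetric bilinear forms,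
each of which is diagonal with `n` entries `1` and `m` entries `-1` in some basis. -/
structure IsPseudoRiemannianMetric (n m : ℕ) (g : FormField I M) : Prop where
  smooth : IsSmooth g
  symm : ∀ (x : M) (v w : TangentSpace I x), g x v w = g x w v
  signature : ∀ x : M, ∃ b : Module.Basis (Fin n ⊕ Fin m) ℝ (TangentSpace I x),
    ∀ i j, g x (b i) (b j) = if i = j then Sum.elim (fun _ ↦ 1) (fun _ ↦ -1) i else 0

variable (I) in
/-- The components at `q`, for `q` near `x`, of a field of bilinear forms in the coordinate frame of
the preferred chart at `x`. -/
def formCoord (g : FormField I M) (x q : M) : E →L[ℝ] E →L[ℝ] ℝ :=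
  pullbackForm (g q) ((trivializationAt E (TangentSpace I : M → Type _) x).symmL ℝ q)

/-- The derivatives `(u, v, w) ↦ ∂_u g(v, w)` at `x` in the preferred chart at `x`. -/
def formCoordDeriv (g : FormField I M) (x : M) : E →L[ℝ] E →L[ℝ] E →L[ℝ] ℝ :=
  (d% (formCoord I g x) x) ∘L
    ((trivializationAt E (TangentSpace I : M → Type _) x).symmL ℝ x)

/-- The Koszul form `(v, w) ↦ ½ (∂_v g(s, w) + ∂_s g(v, w) - ∂_w g(s, v))` at `x`, i.e. the
Christoffel symbol of the first kind in the preferred chart at `x`. -/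
def koszul (g : FormField I M) (x : M) (s : TangentSpace I x) :
    TangentSpace I x →L[ℝ] TangentSpace I x →L[ℝ] ℝ :=
  let C := (trivializationAt E (TangentSpace I : M → Type _) x).continuousLinearMapAt ℝ x
  let A := formCoordDeriv g x
  pullbackForm ((1 / 2 : ℝ) • (A.flip (C s) + A (C s) - (A.flip (C s)).flip)) C

/-- The components at `q`, for `q` near `x`, of a vector field in the coordinate frame of the
preferred chart at `x`. -/
def fieldCoord (Y : Π x : M, TangentSpace I x) (x q : M) : E :=
  (trivializationAt E (TangentSpace I : M → Type _) x ⟨q, Y q⟩).2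

variable {g : FormField I M}

lemma koszul_apply (x : M) (s v w : TangentSpace I x) :
    koszul g x s v w =
      let C := (trivializationAt E (TangentSpace I : M → Type _) x).continuousLinearMapAt ℝ x
      let A := formCoordDeriv g x
      (1 / 2 : ℝ) * (A (C v) (C s) (C w) + A (C s) (C v) (C w) - A (C w) (C s) (C v)) := by
  simp [koszul, pullbackForm_apply]

lemma koszul_add (x : M) (s s' : TangentSpace I x) :
    koszul g x (s + s') = koszul g x s + koszul g x s' := by
  ext v w
  simp [koszul_apply]
  ring

lemma koszul_smul (x : M) (c : ℝ) (s : TangentSpace I x) :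
    koszul g x (c • s) = c • koszul g x s := by
  ext v w
  simp [koszul_apply]
  ring


lemma eventually_mem_baseSet (x : M) :
    ∀ᶠ q in 𝓝 x, q ∈ (trivializationAt E (TangentSpace I : M → Type _) x).baseSet :=
  (trivializationAt E (TangentSpace I : M → Type _) x).open_baseSet.mem_nhds
    (FiberBundle.mem_baseSet_trivializationAt' x)

lemma mdifferentiableAt_fieldCoord {Y : Π x : M, TangentSpace I x} {x : M}
    (hY : MDiffAt (T% Y) x) : MDiffAt (fieldCoord Y x) x := by
  rwa [mdifferentiableAt_section] at hY

lemma mvfderiv_fieldCoord_add {Y Y' : Π x : M, TangentSpace I x} {x : M}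
    (hY : MDiffAt (T% Y) x) (hY' : MDiffAt (T% Y') x) :
    d% (fieldCoord (Y + Y') x) x = d% (fieldCoord Y x) x + d% (fieldCoord Y' x) x := by
  rw [← mvfderiv_add (mdifferentiableAt_fieldCoord hY) (mdifferentiableAt_fieldCoord hY')]
  refine mvfderiv_congr ?_
  filter_upwards [eventually_mem_baseSet (I := I) x] with q hq
  exact ((trivializationAt E (TangentSpace I : M → Type _) x).linear ℝ hq).map_add (Y q) (Y' q)

lemma mvfderiv_fieldCoord_smul {Y : Π x : M, TangentSpace I x} {f : M → ℝ} {x : M}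
    (hY : MDiffAt (T% Y) x) (hf : MDiffAt f x) :
    d% (fieldCoord (f • Y) x) x =
      f x • d% (fieldCoord Y x) x + (d% f x).smulRight (fieldCoord Y x x) := by
  rw [← mvfderiv_smul hf (mdifferentiableAt_fieldCoord hY)]
  refine mvfderiv_congr ?_
  filter_upwards [eventually_mem_baseSet (I := I) x] with q hq
  exact ((trivializationAt E (TangentSpace I : M → Type _) x).linear ℝ hq).map_smul (f q) (Y q)

lemma symmL_fieldCoord (Y : Π x : M, TangentSpace I x) {x q : M}
    (hq : q ∈ (trivializationAt E (TangentSpace I : M → Type _) x).baseSet) :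
    (trivializationAt E (TangentSpace I : M → Type _) x).symmL ℝ q (fieldCoord Y x q) = Y q := by
  have h := (trivializationAt E (TangentSpace I : M → Type _) x).symmL_continuousLinearMapAt
    (R := ℝ) hq (Y q)
  rwa [Bundle.Trivialization.continuousLinearMapAt_apply,
    Bundle.Trivialization.coe_linearMapAt_of_mem _ hq] at h

/-- The Levi-Civita connection of `g`. In Mathlib's convention `leviCivita g Y x v` is
`(D_v Y)(x)`. -/
def leviCivita (g : FormField I M) :
    CovariantDerivative I E (TangentSpace I : M → Type _) where
  toFun Y x :=
    ((trivializationAt E (TangentSpace I : M → Type _) x).symmL ℝ x) ∘L (d% (fieldCoord Y x) x) +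
    (g x).inverse ∘L koszul g x (Y x)
  isCovariantDerivativeOnUniv :=
    { add := by
        intro Y Y' x hY hY' _
        rw [mvfderiv_fieldCoord_add hY hY', Pi.add_apply, koszul_add]
        simp only [ContinuousLinearMap.comp_add]
        abel
      leibniz := by
        intro Y f x hY hf _
        ext v
        simp [mvfderiv_fieldCoord_smul hY hf, koszul_smul,
          symmL_fieldCoord Y (FiberBundle.mem_baseSet_trivializationAt' x)]
        abel }

lemma leviCivita_apply (Y : Π x : M, TangentSpace I x) (x : M) (v : TangentSpace I x) :
    leviCivita g Y x v =
      (trivializationAt E (TangentSpace I : M → Type _) x).symmL ℝ x (d% (fieldCoord Y x) x v) +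
      (g x).inverse (koszul g x (Y x) v) := rfl

theorem mdifferentiableAt_formCoord {x : M}
  (hg : IsSmooth g) :
   MDiffAt (formCoord I g x) x := by
  have hg := hg.mdifferentiableAt (x := x) (by simp)
  rw [mdifferentiableAt_section] at hg
  refine hg.congr_of_eventuallyEq ?_
  filter_upwards [eventually_mem_baseSet (I := I) x] with q hq
  ext v w
  simp only [formCoord, pullbackForm_apply, hom_trivializationAt_apply]
  rw [inCoordinates_apply_eq₂ hq hq (by simp)]
  rw [Bundle.Trivialization.symmL_apply _ hq,
    Bundle.Trivialization.symmL_apply _ hq]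
  simp

lemma mlieBracket_extend (x : M) (u v : TangentSpace I x) :
    VectorField.mlieBracket I (FiberBundle.extend E u) (FiberBundle.extend E v) x = 0 := by
  have key : ∀ u : TangentSpace I x,
      VectorField.mpullbackWithin 𝓘(ℝ, E) I (extChartAt I x).symm (FiberBundle.extend E u)
        (Set.range I) =ᶠ[𝓝[Set.range I] (extChartAt I x x)]
      fun _ ↦ (trivializationAt E (TangentSpace I : M → Type _) x ⟨x, u⟩).2 := by
    intro u
    filter_upwards [extChartAt_target_mem_nhdsWithin (I := I) x] with y hy
    have hy' : (extChartAt I x).symm y ∈ (chartAt H x).source := by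
      simpa using (extChartAt I x).map_target hy
    have h := TangentBundle.symmL_trivializationAt (I := I) hy'
    rw [(extChartAt I x).right_inv hy] at h
    have h1 : FiberBundle.extend E u ((extChartAt I x).symm y) =
      mfderiv[Set.range I] (extChartAt I x).symm y
        (trivializationAt E (TangentSpace I : M → Type _) x ⟨x, u⟩).2 := by
      have := congrArg (fun L => L (trivializationAt E (TangentSpace I : M → Type _) x ⟨x, u⟩).2) h
      rw [Bundle.Trivialization.symmL_apply _ (by simpa using hy')] at this
      exact this
    rw [VectorField.mpullbackWithin_apply, h1]
    exact (isInvertible_mfderivWithin_extChartAt_symm hy).inverse_apply_eq.2 rfl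
  rw [← VectorField.mlieBracketWithin_univ, VectorField.mlieBracketWithin_apply]
  simp only [Set.preimage_univ, Set.univ_inter]
  rw [(key u).lieBracketWithin_vectorField_eq_of_mem (key v) (Set.mem_range_self _)]
  simp only [VectorField.lieBracketWithin, fderivWithin_const_apply]
  exact (congrArg _ (sub_self _)).trans (map_zero _)

lemma fieldCoord_extend {x : M} (u : TangentSpace I x) :
    fieldCoord (FiberBundle.extend E u) x =ᶠ[𝓝 x]
      fun _ ↦ (trivializationAt E (TangentSpace I : M → Type _) x ⟨x, u⟩).2 := by
  filter_upwards [eventually_mem_baseSet (I := I) x] with q hq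
  have h := (trivializationAt E (TangentSpace I : M → Type _) x).apply_mk_symm hq
    (trivializationAt E (TangentSpace I : M → Type _) x ⟨x, u⟩).2
  exact (congrArg Prod.snd h :)

lemma formCoordDeriv_symm {x : M} (hg : MDiffAt (formCoord I g x) x)
    (hsymm : ∀ x v w, g x v w = g x w v) (u v w : E) :
    formCoordDeriv g x u v w = formCoordDeriv g x u w v := by
  have h : ∀ a b : E, formCoordDeriv g x u a b =
      d% (fun q ↦ formCoord I g x q a b) x
        ((trivializationAt E (TangentSpace I : M → Type _) x).symmL ℝ x u) := by
    intro a b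
    rw [mvfderiv_clm_apply (hg.clm_apply mdifferentiableAt_const) mdifferentiableAt_const,
      mvfderiv_clm_apply hg mdifferentiableAt_const]
    simp [formCoordDeriv, mvfderiv_const]
  rw [h, h]
  congr 2
  ext q
  simp only [formCoord, pullbackForm_apply]
  exact hsymm _ _ _

theorem leviCivita_torsion [FiniteDimensional ℝ E] [CompleteSpace E] [IsManifold I 2 M]
  (hg : IsSmooth g)
   (hsymm : ∀ x v w, g x v w = g x w v) : (leviCivita g).torsion = 0 := by
  ext x u v
  rw [CovariantDerivative.torsion_apply_eq_extend, mlieBracket_extend]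
  simp only [FiberBundle.extend_apply_self]
  have hk : koszul g x v u = koszul g x u v := by
    ext w
    simp only [koszul_apply]
    rw [formCoordDeriv_symm (mdifferentiableAt_formCoord hg) hsymm
      ((trivializationAt E (TangentSpace I : M → Type _) x).continuousLinearMapAt ℝ x w)]
    ring
  simp [leviCivita_apply, mvfderiv_congr (fieldCoord_extend _), hk, mvfderiv_const]

theorem leviCivita_metric {x : M}
  (hg : IsSmooth g)
   (hsymm : ∀ x v w, g x v w = g x w v)
   (hnd : (g x).IsInvertible) {Y Z : Π x : M, TangentSpace I x}
    (hY : MDiffAt (T% Y) x) (hZ : MDiffAt (T% Z) x) (v : TangentSpace I x) :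
   d% (fun q ↦ g q (Y q) (Z q)) x v = g x (leviCivita g Y x v) (Z x) + g x (Y x) (leviCivita g Z x v) := by
  have hx := FiberBundle.mem_baseSet_trivializationAt' (F := E)
    (E := (TangentSpace I : M → Type _)) x
  have hG := mdifferentiableAt_formCoord hg (x := x)
  have hy := mdifferentiableAt_fieldCoord hY
  have hz := mdifferentiableAt_fieldCoord hZ
  have h1 : (fun q ↦ g q (Y q) (Z q)) =ᶠ[𝓝 x]
      fun q ↦ formCoord I g x q (fieldCoord Y x q) (fieldCoord Z x q) := by
    filter_upwards [eventually_mem_baseSet (I := I) x] with q hq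
    simp only [formCoord, pullbackForm_apply, symmL_fieldCoord _ hq]
  have hinv : ∀ φ w, g x ((g x).inverse φ) w = φ w := by
    intro φ w
    rw [hnd.self_apply_inverse]
  have hc : ∀ Y : Π x : M, TangentSpace I x,
      (trivializationAt E (TangentSpace I : M → Type _) x).continuousLinearMapAt ℝ x (Y x) =
        fieldCoord Y x x := fun Y ↦
    by rw [Bundle.Trivialization.continuousLinearMapAt_apply,
      Bundle.Trivialization.coe_linearMapAt_of_mem _ hx]; rfl
  have hA : ∀ a b, d% (formCoord I g x) x v a b = formCoordDeriv g x
      ((trivializationAt E (TangentSpace I : M → Type _) x).continuousLinearMapAt ℝ x v) a b := by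
    intro a b
    simp only [formCoordDeriv, ContinuousLinearMap.comp_apply]
    rw [Bundle.Trivialization.symmL_continuousLinearMapAt _ hx]
  rw [mvfderiv_congr h1, mvfderiv_clm_apply (hG.clm_apply hy) hz, mvfderiv_clm_apply hG hy]
  simp only [leviCivita_apply, map_add, add_apply, hinv]
  rw [hsymm x (Y x) ((g x).inverse _), hinv, koszul_apply, koszul_apply]
  simp only [hc, hA]
  simp only [formCoord, pullbackForm_apply, symmL_fieldCoord _ hx]
  have hs := fun a b c ↦ formCoordDeriv_symm hG hsymm a b c
  set C := (trivializationAt E (TangentSpace I : M → Type _) x).continuousLinearMapAt ℝ x v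
  set y := fieldCoord Y x x
  set z := fieldCoord Z x x
  linear_combination (1 / 2 : ℝ) * hs C y z + (1 / 2 : ℝ) * hs y z C - (1 / 2 : ℝ) * hs z C y

end Connection

/-! ### Tensor calculus -/

section Tensors

variable [IsManifold I 1 M]

/-- The covariant derivative `(D_w T)(a, b) = w(T(A, B)) - T(D_w A, b) - T(a, D_w B)` of a
`(0,2)`-tensor field at `x`, where `A` and `B` are vector fields extending `a` and `b`. -/
def covDeriv (D : CovariantDerivative I E (TangentSpace I : M → Type _)) (T : FormField I M)
    (x : M) (w a b : TangentSpace I x) : ℝ :=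
  d% (fun q ↦ T q (FiberBundle.extend E a q) (FiberBundle.extend E b q)) x w
    - T x (D (FiberBundle.extend E a) x w) b
    - T x a (D (FiberBundle.extend E b) x w)

/-- The second covariant derivative
`(D²_{v,w} T)(a, b) = (D_V D_W T)(A, B) - (D_{D_V W} T)(A, B)` of a `(0,2)`-tensor field at `x`,
where `W`, `A` and `B` are vector fields extending `w`, `a` and `b`; that is, the covariant
derivative of the `(0,3)`-tensor field `(w, a, b) ↦ (D_w T)(a, b)`. -/
def secondCovDeriv (D : CovariantDerivative I E (TangentSpace I : M → Type _)) (T : FormField I M)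
    (x : M) (v w a b : TangentSpace I x) : ℝ :=
  d% (fun q ↦ covDeriv D T q (FiberBundle.extend E w q) (FiberBundle.extend E a q)
      (FiberBundle.extend E b q)) x v
    - covDeriv D T x (D (FiberBundle.extend E w) x v) a b
    - covDeriv D T x w (D (FiberBundle.extend E a) x v) b
    - covDeriv D T x w a (D (FiberBundle.extend E b) x v)

/-- The Laplacian `(Δ T)(a, b)` of a `(0,2)`-tensor field: the trace of its second covariant
derivative with respect to the Levi-Civita connection of `g`. -/
def laplacian [FiniteDimensional ℝ E] (g T : FormField I M) (x : M) (a b : TangentSpace I x) : ℝ :=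
  metricTrace (g x) fun v w ↦ secondCovDeriv (leviCivita g) T x v w a b

/-- The vector `(D_U D_V W - D_V D_U W - D_{[U,V]} W)(x)`, where `U`, `V` and `W` are vector fields
extending `u`, `v` and `w`. -/
def curvatureVector (D : CovariantDerivative I E (TangentSpace I : M → Type _)) (x : M)
    (u v w : TangentSpace I x) : TangentSpace I x :=
  let U := FiberBundle.extend E u
  let V := FiberBundle.extend E v
  let W := FiberBundle.extend E w
  D (fun q ↦ D W q (V q)) x u - D (fun q ↦ D W q (U q)) x v - D W x (VectorField.mlieBracket I U V x)

/-- The Riemann curvature tensor, with the sign convention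
`R(U,V,W,Z) = -g(D_U D_V W - D_V D_U W - D_{[U,V]} W, Z)`. -/
def curvature (g : FormField I M) (x : M) (u v w z : TangentSpace I x) : ℝ :=
  -g x (curvatureVector (leviCivita g) x u v w) z

end Tensors

/-! ### Submanifolds, given by the immersion `F : M → M'` -/

section Submanifold

variable {E' : Type*} [NormedAddCommGroup E'] [NormedSpace ℝ E']
  {H' : Type*} [TopologicalSpace H'] {I' : ModelWithCorners ℝ E' H'}
  {M' : Type*} [TopologicalSpace M'] [ChartedSpace H' M']

variable (I) in
/-- The restriction of a `(0,2)`-tensor field on `M'` to `M`. -/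
def restrictForm (F : M → M') (T : FormField I' M') : FormField I M :=
  fun p ↦ pullbackForm (T (F p)) (mfderiv I I' F p)

variable (I) in
/-- `F : M → M'` is smooth and the restriction of the pseudo-metric `g` to `M` is positive definite
(so `F` is an immersion). -/
structure IsSpacelikeImmersion (g : FormField I' M') (F : M → M') : Prop where
  contMDiff : ContMDiff I I' ∞ F
  pos : ∀ (p : M) (v : TangentSpace I p), v ≠ 0 → 0 < restrictForm I F g p v v

variable [IsManifold I' 1 M']

/-- The covariant derivative `D_v Z` at `p` of a vector field `Z` along `F : M → M'`: writing
`Z = ∑ zᵅ (∂_α ∘ F)` in the coordinate frame `(∂_α)` of the preferred chart of `M'` at `F p`, it is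
`∑ dzᵅ(v) ∂_α + zᵅ D_{dF(v)} ∂_α`. -/
def covDerivAlong (D : CovariantDerivative I' E' (TangentSpace I' : M' → Type _)) (F : M → M')
    (Z : Π p : M, TangentSpace I' (F p)) (p : M) (v : TangentSpace I p) : TangentSpace I' (F p) :=
  let t := trivializationAt E' (TangentSpace I' : M' → Type _) (F p)
  t.symmL ℝ (F p) (d% (fun q ↦ (t ⟨F q, Z q⟩).2) p v)
    + D (FiberBundle.extend E' (Z p)) (F p) (mfderiv I I' F p v)

/-- For the restriction of a vector field `Y` on `M'`, the derivative along `F` is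
`D_{dF(v)} Y`. -/
theorem covDerivAlong_comp (g : FormField I' M') {F : M → M'} {Y : Π x : M', TangentSpace I' x}
    {p : M} (hF : MDiffAt F p) (hY : MDiffAt (T% Y) (F p)) (v : TangentSpace I p) :
    covDerivAlong (leviCivita g) F (fun q ↦ Y (F q)) p v
      = leviCivita g Y (F p) (mfderiv I I' F p v) := by
  have h : d% (fieldCoord Y (F p) ∘ F) p v = d% (fieldCoord Y (F p)) (F p) (mfderiv I I' F p v) :=
    congrArg (fun L ↦ L v) (mfderiv_comp p (mdifferentiableAt_fieldCoord hY) hF)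
  have h0 : d% (fieldCoord (FiberBundle.extend E' (Y (F p))) (F p)) (F p) = 0 := by
    rw [mvfderiv_congr (fieldCoord_extend _), mvfderiv_const]
  rw [leviCivita_apply, ← h]
  simp only [covDerivAlong, leviCivita_apply, h0, FiberBundle.extend_apply_self]
  rw [zero_apply, map_zero, zero_add]
  rfl

variable [IsManifold I 1 M]

/-- The second fundamental form `II(x, y) = D'_X Y - D_X Y` at `p`, where `D'` and `D` are the
Levi-Civita connections of `M'` and of `M`, and `Y` is a tangential vector field extending `y`. -/
def secondFundamentalForm (g : FormField I' M') (F : M → M') (p : M) (x y : TangentSpace I p) :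
    TangentSpace I' (F p) :=
  covDerivAlong (leviCivita g) F (fun q ↦ mfderiv I I' F q (FiberBundle.extend E y q)) p x
    - mfderiv I I' F p (leviCivita (restrictForm I F g) (FiberBundle.extend E y) p x)

variable (I) in
/-- The mean curvature vector, i.e. the trace of the second fundamental form, vanishes. -/
def HasZeroMeanCurvature [FiniteDimensional ℝ E] (g : FormField I' M') (F : M → M') : Prop :=
  ∀ p : M, metricTrace (restrictForm I F g p) (secondFundamentalForm g F p) = 0

end Submanifold

end SpacelikeGeometry

end

open SpacelikeGeometry

open scoped Manifold ContDiff Topology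

noncomputable section

namespace SpacelikeGeometry

/-! ### Tensor calculus in a vector space with Christoffel symbols; Codazzi and the pullback
formulas. -/

section Coordinates

set_option maxSynthPendingDepth 4

variable {E E' F₁ F₂ F₃ G : Type*} [NormedAddCommGroup E] [NormedSpace ℝ E]
  [NormedAddCommGroup E'] [NormedSpace ℝ E'] [NormedAddCommGroup F₁] [NormedSpace ℝ F₁]
  [NormedAddCommGroup F₂] [NormedSpace ℝ F₂] [NormedAddCommGroup F₃] [NormedSpace ℝ F₃]
  [NormedAddCommGroup G] [NormedSpace ℝ G]

/-! Write `f` for the immersion in charts, `B` for the second fundamental form and `T` for the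
ambient tensor. Since `B` is the covariant derivative of `df`, applying the Leibniz rule twice to
the pullback of `T` expresses its second covariant derivative through the second derivative of `T`,
first derivatives of `T` paired with one `B`, values of `T` on two `B`s, and values of `T` on the
covariant derivative of `B` (`secondCovDerivForm_pullback`). In the trace, the derivative of `T` in
the direction `tr B` disappears because the mean curvature vanishes, and the mixed terms pair up and
give the factors 2.

What remains is the vector `N`, the sum over `l` of the derivative of `B` along `e l`, evaluated on
`(e l, X)`. This derivative is taken in the full ambient tangent space and not in the normal bundle,
so `N` also has a tangential part. By the symmetry of `B` and the Codazzi equation (`codazzi`), `N`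
is the derivative along `X` of `tr B`, plus the ambient curvature term `∑ R'(e l, X) e l`, minus `df
ρ` for a tangent vector `ρ` coming from the curvature of `M`. The first summand is zero
(`sum_covDerivSff_eq_zero`); here the mean curvature must vanish in a neighbourhood and not just at
the point. The vector `ρ` need not be computed by the Gauss equation: it is determined by its
products with the `e k`, and these follow from the tangential part of `N`, which is quadratic in `B`
by differentiating the normality of `B` (`covDerivSff_tangential`). This gives
`apply_sum_covDerivSff`, and then `sum_secondCovDerivForm_pullback`.

All of this takes place in vector spaces. The intrinsic objects are defined at each point through
that point's own preferred chart and through extensions of vectors, so the rest of the proof shows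
that each of them has the expected expression in one fixed chart. For the connection this rests on
its uniqueness as the torsion-free metric connection (`leviCivita_coordField`, `leviCivita_coord`);
for derivatives along the map, on the cancellation of the derivatives of the transition maps
(`covDerivAlong_coord`). -/

lemma fderiv_clm_apply₁ {K : E → F₁ →L[ℝ] G} {a : E → F₁} {y : E}
    (hK : DifferentiableAt ℝ K y) (ha : DifferentiableAt ℝ a y) (u : E) :
    fderiv ℝ (fun z ↦ K z (a z)) y u = fderiv ℝ K y u (a y) + K y (fderiv ℝ a y u) := by
  rw [fderiv_clm_apply hK ha]
  simp [add_comm]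

lemma fderiv_clm_apply₂ {K : E → F₁ →L[ℝ] F₂ →L[ℝ] G} {a : E → F₁} {b : E → F₂} {y : E}
    (hK : DifferentiableAt ℝ K y) (ha : DifferentiableAt ℝ a y) (hb : DifferentiableAt ℝ b y)
    (u : E) :
    fderiv ℝ (fun z ↦ K z (a z) (b z)) y u =
      fderiv ℝ K y u (a y) (b y) + K y (fderiv ℝ a y u) (b y) + K y (a y) (fderiv ℝ b y u) := by
  rw [fderiv_clm_apply₁ (hK.clm_apply ha) hb, fderiv_clm_apply₁ hK ha]
  simp

lemma fderiv_clm_apply₃ {K : E → F₁ →L[ℝ] F₂ →L[ℝ] F₃ →L[ℝ] G} {a : E → F₁} {b : E → F₂}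
    {c : E → F₃} {y : E} (hK : DifferentiableAt ℝ K y) (ha : DifferentiableAt ℝ a y)
    (hb : DifferentiableAt ℝ b y) (hc : DifferentiableAt ℝ c y) (u : E) :
    fderiv ℝ (fun z ↦ K z (a z) (b z) (c z)) y u =
      fderiv ℝ K y u (a y) (b y) (c y) + K y (fderiv ℝ a y u) (b y) (c y)
        + K y (a y) (fderiv ℝ b y u) (c y) + K y (a y) (b y) (fderiv ℝ c y u) := by
  rw [fderiv_clm_apply₁ ((hK.clm_apply ha).clm_apply hb) hc, fderiv_clm_apply₂ hK ha hb]
  simp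

/-- This and its analogues with more arguments are used in both directions: evaluating on constant
vectors commutes with differentiation, so identities of tensor components can be differentiated
argument by argument. -/
lemma fderiv_clm_apply_const₁ {K : E → F₁ →L[ℝ] G} {y : E} (hK : DifferentiableAt ℝ K y)
    (u : E) (a : F₁) : fderiv ℝ K y u a = fderiv ℝ (fun z ↦ K z a) y u := by
  rw [fderiv_clm_apply₁ hK (differentiableAt_const a)]
  simp

lemma fderiv_clm_apply_const₂ {K : E → F₁ →L[ℝ] F₂ →L[ℝ] G} {y : E} (hK : DifferentiableAt ℝ K y)
    (u : E) (a : F₁) (b : F₂) : fderiv ℝ K y u a b = fderiv ℝ (fun z ↦ K z a b) y u := by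
  rw [fderiv_clm_apply₂ hK (differentiableAt_const a) (differentiableAt_const b)]
  simp

lemma fderiv_clm_apply_const₃ {K : E → F₁ →L[ℝ] F₂ →L[ℝ] F₃ →L[ℝ] G} {y : E}
    (hK : DifferentiableAt ℝ K y) (u : E) (a : F₁) (b : F₂) (c : F₃) :
    fderiv ℝ K y u a b c = fderiv ℝ (fun z ↦ K z a b c) y u := by
  rw [fderiv_clm_apply₃ hK (differentiableAt_const a) (differentiableAt_const b)
    (differentiableAt_const c)]
  simp

/-- The components of the covariant derivative of a `(0,2)`-tensor field with components `T`, for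
the connection with Christoffel symbols `Γ`. -/
def covDerivForm (Γ : E → E →L[ℝ] E →L[ℝ] E) (T : E → E →L[ℝ] E →L[ℝ] ℝ) (y : E) :
    E →L[ℝ] E →L[ℝ] E →L[ℝ] ℝ :=
  fderiv ℝ T y - ContinuousLinearMap.compL ℝ E E (E →L[ℝ] ℝ) (T y) ∘L Γ y
    - (ContinuousLinearMap.flipₗᵢ ℝ E E ℝ : (E →L[ℝ] E →L[ℝ] ℝ) →L[ℝ] E →L[ℝ] E →L[ℝ] ℝ) ∘L
      ContinuousLinearMap.compL ℝ E E (E →L[ℝ] ℝ)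
        ((ContinuousLinearMap.flipₗᵢ ℝ E E ℝ : (E →L[ℝ] E →L[ℝ] ℝ) →L[ℝ] E →L[ℝ] E →L[ℝ] ℝ) (T y))
        ∘L Γ y

lemma covDerivForm_apply (Γ : E → E →L[ℝ] E →L[ℝ] E) (T : E → E →L[ℝ] E →L[ℝ] ℝ) (y w a b : E) :
    covDerivForm Γ T y w a b = fderiv ℝ T y w a b - T y (Γ y w a) b - T y a (Γ y w b) := by
  simp [covDerivForm]

lemma differentiableAt_covDerivForm {Γ : E → E →L[ℝ] E →L[ℝ] E} {T : E → E →L[ℝ] E →L[ℝ] ℝ} {y : E}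
    (hΓ : DifferentiableAt ℝ Γ y) (hT : ContDiffAt ℝ 2 T y) :
    DifferentiableAt ℝ (covDerivForm Γ T) y := by
  have h1 : DifferentiableAt ℝ (fderiv ℝ T) y :=
    (hT.fderiv_right (m := 1) (by norm_num)).differentiableAt (by norm_num)
  have h2 : DifferentiableAt ℝ T y := hT.differentiableAt (by norm_num)
  unfold covDerivForm
  fun_prop

/-- The components of the second covariant derivative of a `(0,2)`-tensor field with components
`T`, for the connection with Christoffel symbols `Γ`. -/
def secondCovDerivForm (Γ : E → E →L[ℝ] E →L[ℝ] E) (T : E → E →L[ℝ] E →L[ℝ] ℝ) (y v w a b : E) : ℝ :=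
  fderiv ℝ (covDerivForm Γ T) y v w a b - covDerivForm Γ T y (Γ y v w) a b
    - covDerivForm Γ T y w (Γ y v a) b - covDerivForm Γ T y w a (Γ y v b)

/-- The components of the curvature `(u, v, w) ↦ R(u, v) w` of the connection with Christoffel
symbols `Γ`. -/
def curvatureForm (Γ : E → E →L[ℝ] E →L[ℝ] E) (y u v w : E) : E :=
  fderiv ℝ Γ y u v w + Γ y u (Γ y v w) - (fderiv ℝ Γ y v u w + Γ y v (Γ y u w))

/-- The components of the second fundamental form of `f`, for the connections with Christoffel
symbols `Γ'` in the target and `Γ` in the source. -/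
def sffForm (Γ' : E' → E' →L[ℝ] E' →L[ℝ] E') (Γ : E → E →L[ℝ] E →L[ℝ] E) (f : E → E') (y : E) :
    E →L[ℝ] E →L[ℝ] E' :=
  fderiv ℝ (fderiv ℝ f) y
    + (ContinuousLinearMap.compL ℝ E E' E').flip (fderiv ℝ f y) ∘L Γ' (f y) ∘L fderiv ℝ f y
    - ContinuousLinearMap.compL ℝ E E E' (fderiv ℝ f y) ∘L Γ y

variable {Γ' : E' → E' →L[ℝ] E' →L[ℝ] E'} {Γ : E → E →L[ℝ] E →L[ℝ] E} {f : E → E'} {y : E}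

lemma sffForm_apply (v w : E) :
    sffForm Γ' Γ f y v w = fderiv ℝ (fderiv ℝ f) y v w
      + Γ' (f y) (fderiv ℝ f y v) (fderiv ℝ f y w) - fderiv ℝ f y (Γ y v w) := by
  simp [sffForm]

/-- Replaces the non-tensorial second derivative of `f` by `B` and Christoffel terms, which then
cancel against those in the covariant derivatives. -/
lemma fderiv_fderiv_eq (v w : E) :
    fderiv ℝ (fderiv ℝ f) y v w = sffForm Γ' Γ f y v w
      - Γ' (f y) (fderiv ℝ f y v) (fderiv ℝ f y w) + fderiv ℝ f y (Γ y v w) := by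
  rw [sffForm_apply]
  abel

lemma differentiableAt_sffForm (hΓ' : DifferentiableAt ℝ Γ' (f y)) (hΓ : DifferentiableAt ℝ Γ y)
    (hf : ContDiffAt ℝ 3 f y) : DifferentiableAt ℝ (sffForm Γ' Γ f) y := by
  have h1 : DifferentiableAt ℝ (fderiv ℝ (fderiv ℝ f)) y :=
    ((hf.fderiv_right (m := 2) (by norm_num)).fderiv_right (m := 1)
      (by norm_num)).differentiableAt (by norm_num)
  have h2 : DifferentiableAt ℝ (fderiv ℝ f) y :=
    (hf.fderiv_right (m := 2) (by norm_num)).differentiableAt (by norm_num)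
  have h3 : DifferentiableAt ℝ f y := hf.differentiableAt (by norm_num)
  have h4 : DifferentiableAt ℝ (fun z ↦ Γ' (f z)) y := (hΓ'.hasFDerivAt.comp y h3.hasFDerivAt).differentiableAt
  unfold sffForm
  fun_prop

/-- Second derivatives commute and both connections are torsion-free. -/
lemma sffForm_symm (hf : ContDiffAt ℝ 2 f y) (hΓ'_symm : ∀ v w, Γ' (f y) v w = Γ' (f y) w v)
    (hΓ_symm : ∀ v w, Γ y v w = Γ y w v) (v w : E) :
    sffForm Γ' Γ f y v w = sffForm Γ' Γ f y w v := by
  rw [sffForm_apply, sffForm_apply, (hf.isSymmSndFDerivAt (by simp)).eq v w, hΓ'_symm, hΓ_symm]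

/-- The covariant derivative of the second fundamental form. -/
def covDerivSff (Γ' : E' → E' →L[ℝ] E' →L[ℝ] E') (Γ : E → E →L[ℝ] E →L[ℝ] E) (f : E → E')
    (y u v w : E) : E' :=
  fderiv ℝ (sffForm Γ' Γ f) y u v w + Γ' (f y) (fderiv ℝ f y u) (sffForm Γ' Γ f y v w)
    - sffForm Γ' Γ f y (Γ y u v) w - sffForm Γ' Γ f y v (Γ y u w)

/-- The Codazzi equation. -/
lemma codazzi (hΓ' : DifferentiableAt ℝ Γ' (f y)) (hΓ : DifferentiableAt ℝ Γ y)
    (hf : ContDiffAt ℝ 3 f y)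
    (hΓ_symm : ∀ v w, Γ y v w = Γ y w v) (u v w : E) :
    covDerivSff Γ' Γ f y u v w - covDerivSff Γ' Γ f y v u w =
      curvatureForm Γ' (f y) (fderiv ℝ f y u) (fderiv ℝ f y v) (fderiv ℝ f y w)
        - fderiv ℝ f y (curvatureForm Γ y u v w) := by
  have h2 : ContDiffAt ℝ 2 (fderiv ℝ f) y := hf.fderiv_right (by norm_num)
  have hf2 : DifferentiableAt ℝ (fderiv ℝ (fderiv ℝ f)) y :=
    (h2.fderiv_right (m := 1) (by norm_num)).differentiableAt (by norm_num)
  have hf1 : DifferentiableAt ℝ (fderiv ℝ f) y := h2.differentiableAt (by norm_num)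
  have hf0 : DifferentiableAt ℝ f y := hf.differentiableAt (by norm_num)
  have hΓf : DifferentiableAt ℝ (fun z ↦ Γ' (f z)) y := (hΓ'.hasFDerivAt.comp y hf0.hasFDerivAt).differentiableAt
  have hd : ∀ u v w, fderiv ℝ (sffForm Γ' Γ f) y u v w =
      fderiv ℝ (fderiv ℝ (fderiv ℝ f)) y u v w
      + (fderiv ℝ Γ' (f y) (fderiv ℝ f y u) (fderiv ℝ f y v) (fderiv ℝ f y w)
        + Γ' (f y) (fderiv ℝ (fderiv ℝ f) y u v) (fderiv ℝ f y w)
        + Γ' (f y) (fderiv ℝ f y v) (fderiv ℝ (fderiv ℝ f) y u w))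
      - (fderiv ℝ (fderiv ℝ f) y u (Γ y v w) + fderiv ℝ f y (fderiv ℝ Γ y u v w)) := by
    intro u v w
    rw [fderiv_clm_apply_const₂ (differentiableAt_sffForm hΓ' hΓ hf)]
    simp only [sffForm_apply]
    have hcomp : fderiv ℝ (fun z ↦ Γ' (f z)) y = fderiv ℝ Γ' (f y) ∘L fderiv ℝ f y :=
      fderiv_comp y hΓ' hf0
    rw [fderiv_fun_sub (by fun_prop) (by fun_prop), fderiv_fun_add (by fun_prop) (by fun_prop)]
    simp only [add_apply, sub_apply]
    rw [fderiv_clm_apply₂ hΓf (by fun_prop) (by fun_prop),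
      fderiv_clm_apply₁ (a := fun z ↦ Γ z v w) hf1 (by fun_prop)]
    simp only [← fderiv_clm_apply_const₂ hf2, ← fderiv_clm_apply_const₂ hΓ,
      ← fderiv_clm_apply_const₁ hf1, hcomp, ContinuousLinearMap.comp_apply]
  -- After antisymmetrising in `u` and `v`, the second and third derivatives of `f` drop out by
  -- symmetry; the derivatives and products of Christoffel symbols that survive form the two
  -- curvatures.
  have hs2 : ∀ a b, fderiv ℝ (fderiv ℝ f) y a b = fderiv ℝ (fderiv ℝ f) y b a :=
    (hf.of_le (by norm_num)).isSymmSndFDerivAt (n := 2) (by simp)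
  have hs3 : fderiv ℝ (fderiv ℝ (fderiv ℝ f)) y u v w = fderiv ℝ (fderiv ℝ (fderiv ℝ f)) y v u w :=
    by rw [(h2.isSymmSndFDerivAt (by simp)).eq u v]
  simp only [covDerivSff, hd, curvatureForm, sffForm_apply, hs3, map_add, map_sub]
  rw [hs2 v u, hΓ_symm v u]
  abel

/-- The first covariant derivative of the restriction of a `(0,2)`-tensor field. -/
lemma covDerivForm_pullback {T : E' → E' →L[ℝ] E' →L[ℝ] ℝ} {S : E → E →L[ℝ] E →L[ℝ] ℝ}
    (hf : ContDiffAt ℝ 2 f y) (hT : DifferentiableAt ℝ T (f y)) (hSd : DifferentiableAt ℝ S y)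
    (hS : ∀ᶠ z in 𝓝 y, ∀ a b, S z a b = T (f z) (fderiv ℝ f z a) (fderiv ℝ f z b)) (w a b : E) :
    covDerivForm Γ S y w a b =
      covDerivForm Γ' T (f y) (fderiv ℝ f y w) (fderiv ℝ f y a) (fderiv ℝ f y b)
      + T (f y) (sffForm Γ' Γ f y w a) (fderiv ℝ f y b)
      + T (f y) (fderiv ℝ f y a) (sffForm Γ' Γ f y w b) := by
  have hf1 : DifferentiableAt ℝ (fderiv ℝ f) y :=
    (hf.fderiv_right (m := 1) (by norm_num)).differentiableAt (by norm_num)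
  have hf0 : DifferentiableAt ℝ f y := hf.differentiableAt (by norm_num)
  have hTf : DifferentiableAt ℝ (fun z ↦ T (f z)) y := (hT.hasFDerivAt.comp y hf0.hasFDerivAt).differentiableAt
  have hcomp : fderiv ℝ (fun z ↦ T (f z)) y = fderiv ℝ T (f y) ∘L fderiv ℝ f y :=
    fderiv_comp y hT hf0
  have h : (fun z ↦ S z a b) =ᶠ[𝓝 y] fun z ↦ T (f z) (fderiv ℝ f z a) (fderiv ℝ f z b) := by
    filter_upwards [hS] with z hz using hz a b
  rw [covDerivForm_apply, covDerivForm_apply, fderiv_clm_apply_const₂ hSd, h.fderiv_eq,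
    fderiv_clm_apply₂ hTf (by fun_prop) (by fun_prop), ← fderiv_clm_apply_const₁ hf1 w a,
    ← fderiv_clm_apply_const₁ hf1 w b, hcomp, hS.self_of_nhds, hS.self_of_nhds,
    fderiv_fderiv_eq (Γ := Γ) (Γ' := Γ'), fderiv_fderiv_eq (Γ := Γ) (Γ' := Γ')]
  simp only [map_add, map_sub, add_apply, sub_apply, ContinuousLinearMap.comp_apply]
  abel

/-- The second covariant derivative of the restriction of a `(0,2)`-tensor field. -/
lemma secondCovDerivForm_pullback {T : E' → E' →L[ℝ] E' →L[ℝ] ℝ} {S : E → E →L[ℝ] E →L[ℝ] ℝ}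
    (hΓ' : DifferentiableAt ℝ Γ' (f y)) (hΓ : DifferentiableAt ℝ Γ y)
    (hf : ContDiffAt ℝ 3 f y) (hT : ContDiffAt ℝ 2 T (f y)) (hSd : ContDiffAt ℝ 2 S y)
    (hS : ∀ᶠ z in 𝓝 y, ∀ a b, S z a b = T (f z) (fderiv ℝ f z a) (fderiv ℝ f z b)) (v w a b : E) :
    secondCovDerivForm Γ S y v w a b =
      secondCovDerivForm Γ' T (f y) (fderiv ℝ f y v) (fderiv ℝ f y w) (fderiv ℝ f y a)
        (fderiv ℝ f y b)
      + covDerivForm Γ' T (f y) (sffForm Γ' Γ f y v w) (fderiv ℝ f y a) (fderiv ℝ f y b)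
      + covDerivForm Γ' T (f y) (fderiv ℝ f y w) (sffForm Γ' Γ f y v a) (fderiv ℝ f y b)
      + covDerivForm Γ' T (f y) (fderiv ℝ f y w) (fderiv ℝ f y a) (sffForm Γ' Γ f y v b)
      + covDerivForm Γ' T (f y) (fderiv ℝ f y v) (sffForm Γ' Γ f y w a) (fderiv ℝ f y b)
      + covDerivForm Γ' T (f y) (fderiv ℝ f y v) (fderiv ℝ f y a) (sffForm Γ' Γ f y w b)
      + T (f y) (covDerivSff Γ' Γ f y v w a) (fderiv ℝ f y b)
      + T (f y) (fderiv ℝ f y a) (covDerivSff Γ' Γ f y v w b)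
      + T (f y) (sffForm Γ' Γ f y w a) (sffForm Γ' Γ f y v b)
      + T (f y) (sffForm Γ' Γ f y v a) (sffForm Γ' Γ f y w b) := by
  have hf1 : DifferentiableAt ℝ (fderiv ℝ f) y :=
    (hf.fderiv_right (m := 2) (by norm_num)).differentiableAt (by norm_num)
  have hf0 : DifferentiableAt ℝ f y := hf.differentiableAt (by norm_num)
  have hT0 : DifferentiableAt ℝ T (f y) := hT.differentiableAt (by norm_num)
  have hTf : DifferentiableAt ℝ (fun z ↦ T (f z)) y := (hT0.hasFDerivAt.comp y hf0.hasFDerivAt).differentiableAt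
  have hcomp : fderiv ℝ (fun z ↦ T (f z)) y = fderiv ℝ T (f y) ∘L fderiv ℝ f y :=
    fderiv_comp y hT0 hf0
  have hT1 := differentiableAt_covDerivForm hΓ' hT
  have hT1f : DifferentiableAt ℝ (fun z ↦ covDerivForm Γ' T (f z)) y := (hT1.hasFDerivAt.comp y hf0.hasFDerivAt).differentiableAt
  have hcomp1 : fderiv ℝ (fun z ↦ covDerivForm Γ' T (f z)) y =
      fderiv ℝ (covDerivForm Γ' T) (f y) ∘L fderiv ℝ f y := fderiv_comp y hT1 hf0
  have hB := differentiableAt_sffForm hΓ' hΓ hf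
  -- The first-order formula is needed on a neighbourhood, because it is about to be differentiated.
  have hfirst : ∀ᶠ z in 𝓝 y, ∀ w a b, covDerivForm Γ S z w a b =
      covDerivForm Γ' T (f z) (fderiv ℝ f z w) (fderiv ℝ f z a) (fderiv ℝ f z b)
      + T (f z) (sffForm Γ' Γ f z w a) (fderiv ℝ f z b)
      + T (f z) (fderiv ℝ f z a) (sffForm Γ' Γ f z w b) := by
    filter_upwards [hS.eventually_nhds, hf.eventually (by simp), hSd.eventually (by simp),
      hf0.continuousAt.eventually (hT.eventually (by simp))] with z hz hfz hSz hTz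
    exact covDerivForm_pullback (hfz.of_le (by norm_num)) (hTz.differentiableAt (by norm_num))
      (hSz.differentiableAt (by norm_num)) hz
  have h : (fun z ↦ covDerivForm Γ S z w a b) =ᶠ[𝓝 y] fun z ↦
      covDerivForm Γ' T (f z) (fderiv ℝ f z w) (fderiv ℝ f z a) (fderiv ℝ f z b)
      + T (f z) (sffForm Γ' Γ f z w a) (fderiv ℝ f z b)
      + T (f z) (fderiv ℝ f z a) (sffForm Γ' Γ f z w b) := by
    filter_upwards [hfirst] with z hz using hz w a b
  rw [secondCovDerivForm, fderiv_clm_apply_const₃ (differentiableAt_covDerivForm hΓ hSd),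
    h.fderiv_eq, fderiv_fun_add (by fun_prop) (by fun_prop),
    fderiv_fun_add (by fun_prop) (by fun_prop)]
  simp only [add_apply]
  rw [fderiv_clm_apply₃ hT1f (by fun_prop) (by fun_prop) (by fun_prop),
    fderiv_clm_apply₂ hTf (by fun_prop) (by fun_prop),
    fderiv_clm_apply₂ hTf (by fun_prop) (by fun_prop)]
  simp only [← fderiv_clm_apply_const₁ hf1, ← fderiv_clm_apply_const₂ hB]
  simp only [hcomp, hcomp1, hfirst.self_of_nhds, covDerivSff, secondCovDerivForm]
  simp only [fderiv_fderiv_eq (Γ := Γ) (Γ' := Γ') (f := f), map_add, map_sub, add_apply, sub_apply,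
    ContinuousLinearMap.comp_apply]
  -- With the ordinary derivatives of `T` rewritten covariantly, every Christoffel term cancels.
  have e1 : ∀ u c d, fderiv ℝ T (f y) u c d =
      covDerivForm Γ' T (f y) u c d + T (f y) (Γ' (f y) u c) d + T (f y) c (Γ' (f y) u d) := by
    intro u c d
    rw [covDerivForm_apply]
    ring
  simp only [e1]
  ring

variable {g' : E' → E' →L[ℝ] E' →L[ℝ] ℝ} {g : E → E →L[ℝ] E →L[ℝ] ℝ}

/-- The second fundamental form is normal. -/
lemma sffForm_normal (hf : ContDiffAt ℝ 2 f y) (hΓ'_symm : ∀ v w, Γ' (f y) v w = Γ' (f y) w v)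
    (hΓ_symm : ∀ v w, Γ y v w = Γ y w v) (hg' : DifferentiableAt ℝ g' (f y))
    (hg : DifferentiableAt ℝ g y) (hg'_symm : ∀ v w, g' (f y) v w = g' (f y) w v)
    (hgg' : ∀ᶠ z in 𝓝 y, ∀ a b, g z a b = g' (f z) (fderiv ℝ f z a) (fderiv ℝ f z b))
    (hc' : covDerivForm Γ' g' (f y) = 0) (hc : covDerivForm Γ g y = 0) (v w a : E) :
    g' (f y) (sffForm Γ' Γ f y v w) (fderiv ℝ f y a) = 0 := by
  -- Both metrics are parallel, so the pullback formula applied to the metric itself leaves only the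
  -- two terms with `B`: the trilinear form `g'(B(v, a), df b)` is antisymmetric in `a`, `b`. It is
  -- also symmetric in `v`, `a`, and these two symmetries force it to vanish.
  have key : ∀ v a b, g' (f y) (sffForm Γ' Γ f y v a) (fderiv ℝ f y b)
      + g' (f y) (sffForm Γ' Γ f y v b) (fderiv ℝ f y a) = 0 := by
    intro v a b
    have h := covDerivForm_pullback (Γ := Γ) (Γ' := Γ') hf hg' hg hgg' v a b
    rw [hc, hc', hg'_symm (fderiv ℝ f y a)] at h
    simpa using h.symm
  have hs := sffForm_symm (Γ := Γ) (Γ' := Γ') hf hΓ'_symm hΓ_symm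
  have h1 := key v w a
  have h2 := key w a v
  have h3 := key a v w
  rw [hs w a] at h2
  rw [hs a v] at h3
  rw [hs w v] at h2
  linarith

/-- The tangential part of the covariant derivative of the second fundamental form. -/
lemma covDerivSff_tangential (hΓ' : DifferentiableAt ℝ Γ' (f y)) (hΓ : DifferentiableAt ℝ Γ y)
    (hf : ContDiffAt ℝ 3 f y) (hg' : DifferentiableAt ℝ g' (f y))
    (hc' : covDerivForm Γ' g' (f y) = 0)
    (hn : ∀ᶠ z in 𝓝 y, ∀ v w a, g' (f z) (sffForm Γ' Γ f z v w) (fderiv ℝ f z a) = 0)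
    (u v w a : E) :
    g' (f y) (covDerivSff Γ' Γ f y u v w) (fderiv ℝ f y a)
      = - g' (f y) (sffForm Γ' Γ f y v w) (sffForm Γ' Γ f y u a) := by
  have hf1 : DifferentiableAt ℝ (fderiv ℝ f) y :=
    (hf.fderiv_right (m := 2) (by norm_num)).differentiableAt (by norm_num)
  have hf0 : DifferentiableAt ℝ f y := hf.differentiableAt (by norm_num)
  have hgf : DifferentiableAt ℝ (fun z ↦ g' (f z)) y := (hg'.hasFDerivAt.comp y hf0.hasFDerivAt).differentiableAt
  have hcomp : fderiv ℝ (fun z ↦ g' (f z)) y = fderiv ℝ g' (f y) ∘L fderiv ℝ f y :=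
    fderiv_comp y hg' hf0
  have hB := differentiableAt_sffForm hΓ' hΓ hf
  -- Differentiate the normality relation along `u`. The derivative of `df a` contributes `B(u, a)`
  -- and tangential terms, and the latter are orthogonal to `B`.
  have h0 : (fun z ↦ g' (f z) (sffForm Γ' Γ f z v w) (fderiv ℝ f z a)) =ᶠ[𝓝 y] fun _ ↦ 0 := by
    filter_upwards [hn] with z hz using hz v w a
  have h1 : fderiv ℝ (fun z ↦ g' (f z) (sffForm Γ' Γ f z v w) (fderiv ℝ f z a)) y u = 0 := by
    rw [h0.fderiv_eq]
    simp
  rw [fderiv_clm_apply₂ hgf (by fun_prop) (by fun_prop), ← fderiv_clm_apply_const₁ hf1 u a,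
    ← fderiv_clm_apply_const₂ hB u v w, hcomp, fderiv_fderiv_eq (Γ := Γ) (Γ' := Γ')] at h1
  have h2 : covDerivForm Γ' g' (f y) (fderiv ℝ f y u) (sffForm Γ' Γ f y v w) (fderiv ℝ f y a) = 0 := by
    rw [hc']; rfl
  rw [covDerivForm_apply] at h2
  have hn0 := hn.self_of_nhds
  simp only [covDerivSff, map_add, map_sub, add_apply, sub_apply, hn0,
    ContinuousLinearMap.comp_apply] at h1 ⊢
  linarith

end Coordinates

/-! ### Gram matrices and independence of the metric trace from the basis. -/

section Trace

variable {V W : Type*} [AddCommGroup V] [Module ℝ V] [TopologicalSpace V]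
  [IsTopologicalAddGroup V] [ContinuousSMul ℝ V] [AddCommGroup W] [Module ℝ W]
  {ι κ : Type*} [Fintype ι] [DecidableEq ι] [Fintype κ] [DecidableEq κ]

/-- A kernel vector of the Gram matrix is the coordinate vector of something orthogonal to the whole
space. -/
lemma isUnit_det_gram {g : V →L[ℝ] V →L[ℝ] ℝ} (hnd : ∀ v, (∀ w, g w v = 0) → v = 0)
    (b : Module.Basis ι ℝ V) : IsUnit (Matrix.of fun i j ↦ g (b i) (b j)).det := by
  rw [isUnit_iff_ne_zero]
  intro h
  obtain ⟨x, hx, hx0⟩ := Matrix.exists_mulVec_eq_zero_iff.2 h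
  refine hx ?_
  have h1 : ∑ i, x i • b i = 0 := by
    refine hnd _ fun w ↦ ?_
    rw [← b.sum_repr w]
    rw [map_sum g, sum_apply]
    refine Finset.sum_eq_zero fun j _ ↦ ?_
    simp only [map_sum, map_smul, smul_apply]
    have h2 := congrFun hx0 j
    simp only [Matrix.mulVec, dotProduct, Matrix.of_apply, Pi.zero_apply] at h2
    have h3 : ∑ i, x i • g (b j) (b i) = 0 := by
      rw [← h2]
      exact Finset.sum_congr rfl fun i _ ↦ mul_comm _ _
    simp only [← Finset.smul_sum, smul_comm (x _), h3, smul_zero]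
  funext i
  exact Fintype.linearIndependent_iff.1 b.linearIndependent x h1 i

/-- Raising an index: `∑ gⁱʲ g(v, bᵢ) bⱼ = v`. -/
lemma sum_gram_inv_smul {g : V →L[ℝ] V →L[ℝ] ℝ} (hnd : ∀ v, (∀ w, g w v = 0) → v = 0)
    (b : Module.Basis ι ℝ V) (v : V) :
    ∑ i, ∑ j, ((Matrix.of fun i j ↦ g (b i) (b j))⁻¹ i j * g v (b i)) • b j = v := by
  set G := Matrix.of fun i j ↦ g (b i) (b j) with hG
  have hu : G * G⁻¹ = 1 := Matrix.mul_nonsing_inv _ (isUnit_det_gram hnd b)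
  let p : ι → V →ₗ[ℝ] ℝ := fun i ↦
    { toFun := fun v ↦ g v (b i), map_add' := by simp, map_smul' := by simp }
  -- Both sides are linear in `v`, so it is enough to test on the basis, where the coefficients are
  -- the entries of `G * G⁻¹`.
  suffices h : ∑ j, LinearMap.smulRight (∑ i, G⁻¹ i j • p i) (b j) = LinearMap.id by
    have h' := LinearMap.congr_fun h v
    rw [LinearMap.id_apply, LinearMap.sum_apply] at h'
    rw [Finset.sum_comm]
    refine Eq.trans ?_ h'
    refine Finset.sum_congr rfl fun j _ ↦ ?_
    rw [LinearMap.smulRight_apply, LinearMap.sum_apply, Finset.sum_smul]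
    simp [p]
  refine b.ext fun k ↦ ?_
  have h1 : ∀ j, (∑ i, G⁻¹ i j • p i) (b k) = (1 : Matrix ι ι ℝ) k j := by
    intro j
    rw [← hu, Matrix.mul_apply, LinearMap.sum_apply]
    refine Finset.sum_congr rfl fun i _ ↦ ?_
    simp [hG, p, mul_comm]
  rw [LinearMap.sum_apply]
  simp_rw [LinearMap.smulRight_apply, h1]
  simp [Matrix.one_apply]

/-- Raising an index: `∑ gⁱʲ g(bⱼ, v) bᵢ = v`. -/
lemma sum_gram_inv_smul' {g : V →L[ℝ] V →L[ℝ] ℝ} (hsymm : ∀ v w, g v w = g w v)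
    (hnd : ∀ v, (∀ w, g w v = 0) → v = 0) (b : Module.Basis ι ℝ V) (v : V) :
    ∑ i, ∑ j, ((Matrix.of fun i j ↦ g (b i) (b j))⁻¹ i j * g v (b j)) • b i = v := by
  have h := sum_gram_inv_smul hnd b v
  have ht : (Matrix.of fun i j ↦ g (b i) (b j)).transpose = Matrix.of fun i j ↦ g (b i) (b j) := by
    ext i j
    exact hsymm _ _
  rw [Finset.sum_comm] at h
  rw [← ht, ← Matrix.transpose_nonsing_inv]
  exact h

/-- The metric trace can be computed in any basis. -/
lemma metricTrace_eq_sum [FiniteDimensional ℝ V] {g : V →L[ℝ] V →L[ℝ] ℝ}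
    (hsymm : ∀ v w, g v w = g w v) (hnd : ∀ v, (∀ w, g w v = 0) → v = 0)
    (b : Module.Basis ι ℝ V) (B : V →ₗ[ℝ] V →ₗ[ℝ] W) :
    metricTrace g (fun v w ↦ B v w) =
      ∑ i, ∑ j, (Matrix.of fun i j ↦ g (b i) (b j))⁻¹ i j • B (b i) (b j) := by
  rw [metricTrace]
  set c := Module.finBasis ℝ V
  set G := Matrix.of fun i j ↦ g (b i) (b j)
  set K := Matrix.of fun i j ↦ g (c i) (c j)
  -- Expanding the `c k` in the basis `b`, or the `b i` in the basis `c`, turns either trace into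
  -- the same fourfold sum.
  have h1 : ∀ k l, ∑ i, ∑ j, G⁻¹ i j • g (c k) (b i) • B (c l) (b j) = B (c l) (c k) := by
    intro k l
    conv_rhs => rw [← sum_gram_inv_smul hnd b (c k)]
    simp [map_sum, mul_smul, G]
  have h2 : ∀ i j, ∑ l, ∑ k, K⁻¹ l k • g (b i) (c k) • B (c l) (b j) = B (b i) (b j) := by
    intro i j
    conv_rhs => rw [← sum_gram_inv_smul' hsymm hnd c (b i)]
    simp [map_sum, mul_smul, K, LinearMap.sum_apply]
  calc ∑ l, ∑ k, K⁻¹ l k • B (c l) (c k)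
      = ∑ x : _ × _, ∑ y : _ × _,
          K⁻¹ x.1 x.2 • G⁻¹ y.1 y.2 • g (c x.2) (b y.1) • B (c x.1) (b y.2) := by
        simp only [Fintype.sum_prod_type, ← h1, Finset.smul_sum]
    _ = ∑ y : _ × _, ∑ x : _ × _,
          G⁻¹ y.1 y.2 • K⁻¹ x.1 x.2 • g (b y.1) (c x.2) • B (c x.1) (b y.2) := by
        rw [Finset.sum_comm]
        refine Finset.sum_congr rfl fun y _ ↦ Finset.sum_congr rfl fun x _ ↦ ?_
        rw [smul_comm, hsymm (c x.2)]
    _ = ∑ i, ∑ j, G⁻¹ i j • B (b i) (b j) := by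
        simp only [Fintype.sum_prod_type, ← h2, Finset.smul_sum]

lemma metricTrace_eq_sum_of_orthonormal [FiniteDimensional ℝ V] {g : V →L[ℝ] V →L[ℝ] ℝ}
    (hsymm : ∀ v w, g v w = g w v) (hnd : ∀ v, (∀ w, g w v = 0) → v = 0)
    (b : Module.Basis ι ℝ V) (hb : ∀ k l, g (b k) (b l) = if k = l then 1 else 0)
    (B : V →ₗ[ℝ] V →ₗ[ℝ] W) : metricTrace g (fun v w ↦ B v w) = ∑ i, B (b i) (b i) := by
  rw [metricTrace_eq_sum hsymm hnd b]
  have h : (Matrix.of fun i j ↦ g (b i) (b j)) = 1 := by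
    ext i j
    simp [hb, Matrix.one_apply]
  simp [h, Matrix.one_apply]

end Trace

/-! ### Behaviour of the metric trace under linear maps and isometries. -/

section Transport

variable {V V' W W' : Type*} [AddCommGroup V] [Module ℝ V] [TopologicalSpace V]
  [IsTopologicalAddGroup V] [ContinuousSMul ℝ V] [AddCommGroup W] [Module ℝ W]
  [AddCommGroup V'] [Module ℝ V'] [TopologicalSpace V'] [AddCommGroup W'] [Module ℝ W']
  [IsTopologicalAddGroup V'] [ContinuousSMul ℝ V']

lemma map_metricTrace [FiniteDimensional ℝ V] (g : V →L[ℝ] V →L[ℝ] ℝ) (B : V → V → W)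
    (A : W →ₗ[ℝ] W') : A (metricTrace g B) = metricTrace g fun v w ↦ A (B v w) := by
  simp [metricTrace, map_sum]

/-- The isometry `A` carries the basis chosen in `V` to a basis of `V'` with the same Gram matrix,
and the trace may be computed in any basis. -/
lemma metricTrace_comp [FiniteDimensional ℝ V] [FiniteDimensional ℝ V'] {g : V →L[ℝ] V →L[ℝ] ℝ}
    {g' : V' →L[ℝ] V' →L[ℝ] ℝ} (A : V ≃ₗ[ℝ] V') (hA : ∀ v w, g v w = g' (A v) (A w))
    (hsymm : ∀ v w, g' v w = g' w v) (hnd : ∀ v, (∀ w, g' w v = 0) → v = 0)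
    (B : V' →ₗ[ℝ] V' →ₗ[ℝ] W) :
    metricTrace g (fun v w ↦ B (A v) (A w)) = metricTrace g' fun v w ↦ B v w := by
  have hsymm' : ∀ v w, g v w = g w v := fun v w ↦ by rw [hA, hA, hsymm]
  have hnd' : ∀ v, (∀ w, g w v = 0) → v = 0 := fun v hv ↦ by
    rw [← A.map_eq_zero_iff]
    refine hnd _ fun w ↦ ?_
    rw [← A.apply_symm_apply w, ← hA]
    exact hv _
  rw [metricTrace_eq_sum hsymm hnd ((Module.finBasis ℝ V).map A) B]
  refine (metricTrace_eq_sum hsymm' hnd' (Module.finBasis ℝ V)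
    (B.compl₁₂ (A : V →ₗ[ℝ] V') (A : V →ₗ[ℝ] V'))).trans ?_
  simp [hA]

end Transport

/-! ### The divergence of the second fundamental form when the mean curvature vanishes. -/

section Coordinates

set_option maxSynthPendingDepth 4

variable {E E' : Type*} [NormedAddCommGroup E] [NormedSpace ℝ E]
  [NormedAddCommGroup E'] [NormedSpace ℝ E']
  {ι κ : Type*} [Fintype ι] [DecidableEq ι] [Fintype κ] [DecidableEq κ]

lemma differentiableAt_det {A : E → Matrix ι ι ℝ} {y : E}
    (hA : ∀ i j, DifferentiableAt ℝ (fun z ↦ A z i j) y) :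
    DifferentiableAt ℝ (fun z ↦ (A z).det) y := by
  simp only [Matrix.det_apply]
  fun_prop

lemma differentiableAt_matrix_inv {A : E → Matrix ι ι ℝ} {y : E}
    (hA : ∀ i j, DifferentiableAt ℝ (fun z ↦ A z i j) y) (hdet : (A y).det ≠ 0) (i j : ι) :
    DifferentiableAt ℝ (fun z ↦ (A z)⁻¹ i j) y := by
  simp only [Matrix.inv_def, Ring.inverse_eq_inv', Matrix.smul_apply, Matrix.adjugate_apply]
  refine ((differentiableAt_det hA).inv hdet).smul (differentiableAt_det fun k l ↦ ?_)
  -- The cofactor is the determinant of `A` with row `j` replaced by a constant row.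
  by_cases h : k = j
  · subst h
    simp
  · simpa [Matrix.updateRow_ne h] using hA k l

/-- If a matrix function is the identity at `y` and has zero derivative there, then so does its
inverse. -/
lemma fderiv_matrix_inv_eq_zero {A : E → Matrix ι ι ℝ} {y : E}
    (hA : ∀ i j, DifferentiableAt ℝ (fun z ↦ A z i j) y) (hA1 : A y = 1)
    (hA0 : ∀ i j, fderiv ℝ (fun z ↦ A z i j) y = 0) (i j : ι) :
    fderiv ℝ (fun z ↦ (A z)⁻¹ i j) y = 0 := by
  have hdet : (A y).det ≠ 0 := by simp [hA1]
  have hinv := differentiableAt_matrix_inv hA hdet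
  -- Near `y` the product of the inverse with `A` is constant; differentiating it at a point where
  -- `A` is the identity with zero derivative leaves only the derivative of the inverse.
  have h : (fun z ↦ ∑ k, (A z)⁻¹ i k * A z k j) =ᶠ[𝓝 y] fun _ ↦ (1 : Matrix ι ι ℝ) i j := by
    filter_upwards [(differentiableAt_det hA).continuousAt.eventually_ne hdet] with z hz
    rw [← Matrix.mul_apply, Matrix.nonsing_inv_mul _ (isUnit_iff_ne_zero.2 hz)]
  have h1 := h.fderiv_eq (𝕜 := ℝ)
  rw [fderiv_fun_sum fun k _ ↦ (hinv i k).fun_mul (hA k j)] at h1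
  simp_rw [fderiv_fun_mul (hinv i _) (hA _ j), hA0, hA1] at h1
  simpa [Matrix.one_apply] using h1

variable {Γ' : E' → E' →L[ℝ] E' →L[ℝ] E'} {Γ : E → E →L[ℝ] E →L[ℝ] E} {f : E → E'} {y : E}
  {g' : E' → E' →L[ℝ] E' →L[ℝ] ℝ} {g : E → E →L[ℝ] E →L[ℝ] ℝ}

/-- The second fundamental form as a bilinear map. -/
def sffLin (Γ' : E' → E' →L[ℝ] E' →L[ℝ] E') (Γ : E → E →L[ℝ] E →L[ℝ] E) (f : E → E') (y : E) :
    E →ₗ[ℝ] E →ₗ[ℝ] E' :=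
  LinearMap.mk₂ ℝ (fun v w ↦ sffForm Γ' Γ f y v w) (by simp) (by simp) (by simp) (by simp)

/-- If the mean curvature vanishes near `y`, so does the trace at `y` of the covariant derivative of
the second fundamental form. -/
lemma sum_covDerivSff_eq_zero [FiniteDimensional ℝ E]
    (hΓ' : DifferentiableAt ℝ Γ' (f y)) (hΓ : DifferentiableAt ℝ Γ y)
    (hf : ContDiffAt ℝ 3 f y) (hg : DifferentiableAt ℝ g y)
    (hg_symm : ∀ᶠ z in 𝓝 y, ∀ v w, g z v w = g z w v)
    (hg_nd : ∀ᶠ z in 𝓝 y, ∀ v, (∀ w, g z w v = 0) → v = 0) (hc : covDerivForm Γ g y = 0)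
    (hH : ∀ᶠ z in 𝓝 y, metricTrace (g z) (fun v w ↦ sffForm Γ' Γ f z v w) = 0)
    (e : Module.Basis ι ℝ E) (he : ∀ k l, g y (e k) (e l) = if k = l then 1 else 0) (x : E) :
    ∑ l, covDerivSff Γ' Γ f y x (e l) (e l) = 0 := by
  have hB := differentiableAt_sffForm hΓ' hΓ hf
  -- The fields `c l z = A z (e l)` extend the orthonormal basis so that their covariant derivatives
  -- vanish at `y`. To first order this is a parallel frame, and an exactly orthonormal frame near
  -- `y` is not needed.
  let A : E → E →L[ℝ] E := fun z ↦ 1 - Γ y (z - y)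
  have hA : DifferentiableAt ℝ A y := by fun_prop
  have hAy : A y = 1 := by simp [A]
  let c : ι → E → E := fun l z ↦ A z (e l)
  have hcd : ∀ l, DifferentiableAt ℝ (c l) y := fun l ↦ by fun_prop
  have hc0 : ∀ l, c l y = e l := fun l ↦ by simp [c, hAy]
  have hc' : ∀ l u, fderiv ℝ (c l) y u = - Γ y u (e l) := by
    intro l u
    have h1 : HasFDerivAt A (-(Γ y)) y := by
      have h2 : HasFDerivAt (fun z ↦ Γ y (z - y)) (Γ y) y := by
        simpa using (Γ y).hasFDerivAt.sub_const (x := y) (Γ y y)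
      exact h2.const_sub 1
    have h2 : fderiv ℝ A y u (e l) = fderiv ℝ (c l) y u := fderiv_clm_apply_const₁ hA u (e l)
    rw [← h2, h1.fderiv]
    rfl
  let h : E → Matrix ι ι ℝ := fun z ↦ Matrix.of fun i j ↦ g z (c i z) (c j z)
  have hd : ∀ i j, DifferentiableAt ℝ (fun z ↦ h z i j) y := fun i j ↦
    (hg.clm_apply (hcd i)).clm_apply (hcd j)
  have h1 : h y = 1 := by
    ext i j
    simp [h, hc0, he, Matrix.one_apply]
  -- The metric is parallel and so is the frame at `y`, hence the Gram matrix is constant to first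
  -- order, and so is its inverse.
  have h0 : ∀ i j, fderiv ℝ (fun z ↦ h z i j) y = 0 := by
    intro i j
    ext u
    have h2 := fderiv_clm_apply₂ hg (hcd i) (hcd j) u
    have h3 : covDerivForm Γ g y u (e i) (e j) = 0 := by rw [hc]; rfl
    rw [covDerivForm_apply] at h3
    rw [hc', hc', hc0, hc0] at h2
    refine h2.trans ?_
    simp only [map_neg, neg_apply, zero_apply]
    linarith
  have hev : ∀ᶠ z in 𝓝 y, ∑ i, ∑ j, (h z)⁻¹ i j • sffForm Γ' Γ f z (c i z) (c j z) = 0 := by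
    -- Invertibility is an open condition and `A y = 1`, so the `c l z` form a basis for `z` near
    -- `y`, in which the trace can be computed.
    have hunit : ∀ᶠ z in 𝓝 y, IsUnit (A z) :=
      hA.continuousAt.eventually (Units.isOpen.mem_nhds (by rw [hAy]; exact isUnit_one))
    filter_upwards [hH, hunit, hg_symm, hg_nd] with z hz hAz hs hn
    obtain ⟨U, hU⟩ := hAz
    let L : E ≃ₗ[ℝ] E := (ContinuousLinearEquiv.unitsEquiv ℝ E U).toLinearEquiv
    have h2 := metricTrace_eq_sum hs hn (e.map L) (sffLin Γ' Γ f z)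
    have h3 : ∀ l, e.map L l = c l z := by
      intro l
      simp only [Module.Basis.map_apply, c, ← hU]
      rfl
    simp only [h3] at h2
    exact h2.symm.trans hz
  have hinv := differentiableAt_matrix_inv hd (by simp [h1])
  have hinv0 := fderiv_matrix_inv_eq_zero hd h1 h0
  have hBc : ∀ i j, DifferentiableAt ℝ (fun z ↦ sffForm Γ' Γ f z (c i z) (c j z)) y := fun i j ↦
    (hB.clm_apply (hcd i)).clm_apply (hcd j)
  have hfd : fderiv ℝ (fun z ↦ ∑ i, ∑ j, (h z)⁻¹ i j • sffForm Γ' Γ f z (c i z) (c j z)) y x = 0 := by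
    rw [Filter.EventuallyEq.fderiv_eq (f := fun _ ↦ (0 : E')) hev]
    simp
  have hq : ∀ i j, fderiv ℝ (fun z ↦ (h z)⁻¹ i j • sffForm Γ' Γ f z (c i z) (c j z)) y x =
      if i = j then fderiv ℝ (sffForm Γ' Γ f) y x (e i) (e j)
        - sffForm Γ' Γ f y (Γ y x (e i)) (e j) - sffForm Γ' Γ f y (e i) (Γ y x (e j)) else 0 := by
    intro i j
    rw [fderiv_fun_smul (hinv i j) (hBc i j), hinv0, h1, add_apply, smul_apply,
      fderiv_clm_apply₂ hB (hcd i) (hcd j), hc', hc', hc0, hc0]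
    by_cases hij : i = j
    · simp [hij, sub_eq_add_neg]
    · simp [hij]
  rw [fderiv_fun_sum fun i _ ↦ DifferentiableAt.fun_sum fun j _ ↦ (hinv i j).fun_smul (hBc i j),
    sum_apply] at hfd
  have hfd' : ∑ l, (fderiv ℝ (sffForm Γ' Γ f) y x (e l) (e l)
      - sffForm Γ' Γ f y (Γ y x (e l)) (e l) - sffForm Γ' Γ f y (e l) (Γ y x (e l))) = 0 := by
    rw [← hfd]
    refine Finset.sum_congr rfl fun i _ ↦ ?_
    rw [fderiv_fun_sum fun j _ ↦ (hinv i j).fun_smul (hBc i j), sum_apply]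
    simp [hq]
  have htr : ∑ l, sffForm Γ' Γ f y (e l) (e l) = 0 := by
    have h2 := hev.self_of_nhds
    simpa [h1, hc0, Matrix.one_apply] using h2
  -- The remaining term of the covariant derivative is a Christoffel symbol of the target applied to
  -- the mean curvature vector itself, so the vanishing at `y` is enough for it.
  have hΓtr : Γ' (f y) (fderiv ℝ f y x) (∑ l, sffForm Γ' Γ f y (e l) (e l)) = 0 := by
    rw [htr, map_zero]
  rw [map_sum] at hΓtr
  refine Eq.trans ?_ ((congrArg₂ (· + ·) hfd' hΓtr).trans (add_zero 0))
  rw [← Finset.sum_add_distrib]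
  refine Finset.sum_congr rfl fun l _ ↦ ?_
  rw [covDerivSff]
  abel

/-- The divergence of the second fundamental form of a map with vanishing mean curvature. -/
lemma apply_sum_covDerivSff [FiniteDimensional ℝ E]
    (hΓ' : DifferentiableAt ℝ Γ' (f y)) (hΓ : DifferentiableAt ℝ Γ y)
    (hf : ContDiffAt ℝ 3 f y) (hg' : ContDiffAt ℝ 1 g' (f y)) (hg : ContDiffAt ℝ 1 g y)
    (hΓ'_symm : ∀ᶠ z in 𝓝 (f y), ∀ v w, Γ' z v w = Γ' z w v)
    (hΓ_symm : ∀ᶠ z in 𝓝 y, ∀ v w, Γ z v w = Γ z w v)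
    (hg'_symm : ∀ᶠ z in 𝓝 (f y), ∀ v w, g' z v w = g' z w v)
    (hgg' : ∀ᶠ z in 𝓝 y, ∀ a b, g z a b = g' (f z) (fderiv ℝ f z a) (fderiv ℝ f z b))
    (hg'_nd : ∀ v, (∀ w, g' (f y) w v = 0) → v = 0)
    (hg_nd : ∀ᶠ z in 𝓝 y, ∀ v, (∀ w, g z w v = 0) → v = 0)
    (hc' : ∀ᶠ z in 𝓝 (f y), covDerivForm Γ' g' z = 0) (hc : ∀ᶠ z in 𝓝 y, covDerivForm Γ g z = 0)
    (hH : ∀ᶠ z in 𝓝 y, metricTrace (g z) (fun v w ↦ sffForm Γ' Γ f z v w) = 0)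
    (e : Module.Basis ι ℝ E) (he : ∀ k l, g y (e k) (e l) = if k = l then 1 else 0)
    (b : Module.Basis κ ℝ E') (x : E) (τ : E' →L[ℝ] ℝ) :
    ∑ l, τ (covDerivSff Γ' Γ f y (e l) (e l) x) =
      - (∑ k, ∑ l, g' (f y) (sffForm Γ' Γ f y (e l) x) (sffForm Γ' Γ f y (e l) (e k))
          * τ (fderiv ℝ f y (e k)))
      - (∑ i, ∑ j, ∑ l, (Matrix.of fun i j ↦ g' (f y) (b i) (b j))⁻¹ i j
          * -g' (f y) (curvatureForm Γ' (f y) (fderiv ℝ f y (e l)) (fderiv ℝ f y x)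
            (fderiv ℝ f y (e l))) (b i) * τ (b j))
      + ∑ k, ∑ l, -g' (f y) (curvatureForm Γ' (f y) (fderiv ℝ f y (e l)) (fderiv ℝ f y x)
            (fderiv ℝ f y (e l))) (fderiv ℝ f y (e k)) * τ (fderiv ℝ f y (e k)) := by
  have hfc := hf.continuousAt
  have hsymm : ∀ᶠ z in 𝓝 y, ∀ v w, sffForm Γ' Γ f z v w = sffForm Γ' Γ f z w v := by
    filter_upwards [hf.eventually (by simp), hfc.eventually hΓ'_symm, hΓ_symm] with z h1 h2 h3
    exact sffForm_symm (h1.of_le (by norm_num)) h2 h3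
  have hn : ∀ᶠ z in 𝓝 y, ∀ v w a, g' (f z) (sffForm Γ' Γ f z v w) (fderiv ℝ f z a) = 0 := by
    filter_upwards [hf.eventually (by simp), hfc.eventually hΓ'_symm, hΓ_symm,
      hfc.eventually (hg'.eventually (by simp)), hg.eventually (by simp), hfc.eventually hg'_symm,
      hgg'.eventually_nhds, hfc.eventually hc', hc] with z h1 h2 h3 h4 h5 h6 h7 h8 h9
    exact sffForm_normal (h1.of_le (by norm_num)) h2 h3 (h4.differentiableAt (by norm_num))
      (h5.differentiableAt (by norm_num)) h6 h7 h8 h9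
  have hg_symm : ∀ᶠ z in 𝓝 y, ∀ v w, g z v w = g z w v := by
    filter_upwards [hgg', hfc.eventually hg'_symm] with z h1 h2 v w
    rw [h1, h1, h2]
  have htan := covDerivSff_tangential hΓ' hΓ hf (hg'.differentiableAt (by norm_num))
    hc'.self_of_nhds hn
  have htr := sum_covDerivSff_eq_zero hΓ' hΓ hf (hg.differentiableAt (by norm_num)) hg_symm hg_nd
    hc.self_of_nhds hH e he x
  have hcod := fun l ↦ codazzi hΓ' hΓ hf hΓ_symm.self_of_nhds (e l) x (e l)
  -- The covariant derivative of `B` inherits the symmetry of `B` in its last two arguments; this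
  -- puts `X` where Codazzi can exchange it with `e l`.
  have hswap : ∀ l, covDerivSff Γ' Γ f y (e l) (e l) x = covDerivSff Γ' Γ f y (e l) x (e l) := by
    intro l
    have h1 : (fun z ↦ sffForm Γ' Γ f z (e l) x) =ᶠ[𝓝 y] fun z ↦ sffForm Γ' Γ f z x (e l) := by
      filter_upwards [hsymm] with z hz using hz _ _
    have hB := differentiableAt_sffForm hΓ' hΓ hf
    have hs := hsymm.self_of_nhds
    rw [covDerivSff, covDerivSff, fderiv_clm_apply_const₂ hB, h1.fderiv_eq,
      ← fderiv_clm_apply_const₂ hB, hs (e l) x, hs _ x, hs (e l) (Γ y (e l) x)]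
    abel
  set Q : ι → E' := fun l ↦ curvatureForm Γ' (f y) (fderiv ℝ f y (e l)) (fderiv ℝ f y x)
    (fderiv ℝ f y (e l)) with hQ
  set N : E' := ∑ l, covDerivSff Γ' Γ f y (e l) (e l) x with hN
  -- Only the tangentiality of the intrinsic curvature term matters from here on; its value is
  -- recovered below from its inner products with the basis.
  obtain ⟨ρ, hρ⟩ : ∃ ρ : E, N = ∑ l, Q l - fderiv ℝ f y ρ := by
    refine ⟨∑ l, curvatureForm Γ y (e l) x (e l), ?_⟩
    rw [map_sum, ← Finset.sum_sub_distrib, ← add_zero N, ← neg_zero, ← htr,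
      ← sub_eq_add_neg, hN, ← Finset.sum_sub_distrib]
    exact Finset.sum_congr rfl fun l _ ↦ by rw [hswap, hcod]
  have hg_symm0 := hg_symm.self_of_nhds
  have hρe : ρ = ∑ k, g y ρ (e k) • e k := by
    have h1 := sum_gram_inv_smul hg_nd.self_of_nhds e ρ
    have h2 : (Matrix.of fun i j ↦ g y (e i) (e j)) = 1 := by
      ext i j
      simp [he, Matrix.one_apply]
    rw [h2] at h1
    conv_lhs => rw [← h1]
    simp [Matrix.one_apply]
  -- As `df ρ` is the ambient curvature sum minus `N`, its product with `df (e k)` is computed from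
  -- the tangential part of `N`.
  have hgρ : ∀ k, g y ρ (e k) = ∑ l, g' (f y) (Q l) (fderiv ℝ f y (e k))
      + ∑ l, g' (f y) (sffForm Γ' Γ f y (e l) x) (sffForm Γ' Γ f y (e l) (e k)) := by
    intro k
    have h1 : fderiv ℝ f y ρ = ∑ l, Q l - N := by rw [hρ]; abel
    rw [hgg'.self_of_nhds, h1, hN]
    simp only [map_sub, map_sum, sub_apply, sum_apply, htan, Finset.sum_neg_distrib]
    ring
  have hτQ : ∑ l, τ (Q l) = ∑ i, ∑ j, ∑ l, (Matrix.of fun i j ↦ g' (f y) (b i) (b j))⁻¹ i j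
      * g' (f y) (Q l) (b i) * τ (b j) := by
    have h1 := fun l ↦ congrArg τ (sum_gram_inv_smul hg'_nd b (Q l))
    simp only [map_sum, map_smul, smul_eq_mul] at h1
    rw [← Finset.sum_congr rfl fun l _ ↦ h1 l, Finset.sum_comm]
    exact Finset.sum_congr rfl fun i _ ↦ Finset.sum_comm
  rw [← map_sum, ← hN, hρ, map_sub, map_sum, hτQ, hρe]
  simp only [hgρ, map_sum, map_smul, smul_eq_mul, add_mul, Finset.sum_add_distrib, Finset.sum_mul,
    mul_neg, neg_mul, Finset.sum_neg_distrib]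
  ring

end Coordinates

/-! ### The Christoffel symbols of a metric: symmetry, metric compatibility and regularity. -/

section Christoffel

set_option maxSynthPendingDepth 4

variable {E : Type*} [NormedAddCommGroup E] [NormedSpace ℝ E] {g : E → E →L[ℝ] E →L[ℝ] ℝ} {y : E}

/-- The Christoffel symbols of the metric with components `g`. -/
def christoffelForm (g : E → E →L[ℝ] E →L[ℝ] ℝ) (y : E) : E →L[ℝ] E →L[ℝ] E :=
  ContinuousLinearMap.compL ℝ E (E →L[ℝ] ℝ) E (g y).inverse ∘L ((1 / 2 : ℝ) •
    (fderiv ℝ g y + ContinuousLinearMap.flipₗᵢ ℝ E E (E →L[ℝ] ℝ) (fderiv ℝ g y)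
      - (ContinuousLinearMap.flipₗᵢ ℝ E E ℝ : (E →L[ℝ] E →L[ℝ] ℝ) →L[ℝ] E →L[ℝ] E →L[ℝ] ℝ) ∘L
        ContinuousLinearMap.flipₗᵢ ℝ E E (E →L[ℝ] ℝ) (fderiv ℝ g y)))

lemma apply_christoffelForm (hg : (g y).IsInvertible) (v w z : E) :
    g y (christoffelForm g y v w) z =
      1 / 2 * (fderiv ℝ g y v w z + fderiv ℝ g y w v z - fderiv ℝ g y z v w) := by
  have h : ∀ φ, g y ((g y).inverse φ) = φ := hg.self_apply_inverse
  simp [christoffelForm, h]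

/-- Serves to recognise connection coefficients that satisfy the Koszul identity; nondegeneracy
makes the solution unique. -/
lemma christoffelForm_unique (hg : (g y).IsInvertible) {v w a : E}
    (ha : ∀ z, g y a z = 1 / 2 * (fderiv ℝ g y v w z + fderiv ℝ g y w v z - fderiv ℝ g y z v w)) :
    a = christoffelForm g y v w := by
  refine hg.injective ?_
  ext z
  rw [ha, apply_christoffelForm hg]

lemma fderiv_symm (hg : DifferentiableAt ℝ g y) (hsymm : ∀ᶠ z in 𝓝 y, ∀ v w, g z v w = g z w v)
    (u v w : E) : fderiv ℝ g y u v w = fderiv ℝ g y u w v := by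
  have h : (fun z ↦ g z v w) =ᶠ[𝓝 y] fun z ↦ g z w v := by
    filter_upwards [hsymm] with z hz using hz v w
  rw [fderiv_clm_apply_const₂ hg, fderiv_clm_apply_const₂ hg, h.fderiv_eq]

lemma christoffelForm_symm (hg : DifferentiableAt ℝ g y)
    (hsymm : ∀ᶠ z in 𝓝 y, ∀ v w, g z v w = g z w v) (hinv : (g y).IsInvertible) (v w : E) :
    christoffelForm g y v w = christoffelForm g y w v := by
  refine christoffelForm_unique hinv fun z ↦ ?_
  rw [apply_christoffelForm hinv, fderiv_symm hg hsymm z v w]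
  ring

lemma covDerivForm_christoffelForm (hg : DifferentiableAt ℝ g y)
    (hsymm : ∀ᶠ z in 𝓝 y, ∀ v w, g z v w = g z w v) (hinv : (g y).IsInvertible) :
    covDerivForm (christoffelForm g) g y = 0 := by
  ext u v w
  have hs := fderiv_symm hg hsymm
  rw [covDerivForm_apply, apply_christoffelForm hinv, hsymm.self_of_nhds v,
    apply_christoffelForm hinv, hs u w v, hs v u w, hs w u v, zero_apply, zero_apply, zero_apply]
  ring

/-- Inversion of operators is smooth at invertible ones, and the other factor involves only first
derivatives of `g`. -/
lemma differentiableAt_christoffelForm [CompleteSpace E] (hg : ContDiffAt ℝ 2 g y)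
    (hinv : (g y).IsInvertible) : DifferentiableAt ℝ (christoffelForm g) y := by
  have h1 : DifferentiableAt ℝ (fderiv ℝ g) y :=
    (hg.fderiv_right (m := 1) (by norm_num)).differentiableAt (by norm_num)
  have h2 : DifferentiableAt ℝ g y := hg.differentiableAt (by norm_num)
  have h3 : DifferentiableAt ℝ (fun z ↦ (g z).inverse) y := by
    obtain ⟨e, he⟩ := hinv
    have h := (contDiffAt_map_inverse (𝕜 := ℝ) (n := 1) e).differentiableAt (by norm_num)
    rw [he] at h
    exact (h.hasFDerivAt.comp y h2.hasFDerivAt).differentiableAt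
  unfold christoffelForm
  fun_prop

end Christoffel

/-! ### Functions and tangent vectors read in a fixed chart. -/

section Chart

variable {E : Type*} [NormedAddCommGroup E] [NormedSpace ℝ E]
  {H : Type*} [TopologicalSpace H] {I : ModelWithCorners ℝ E H}
  {M : Type*} [TopologicalSpace M] [ChartedSpace H M]

variable (I) in
/-- The function `f` in the preferred chart at `x`. -/
abbrev inChart {V : Type*} (x : M) (f : M → V) : E → V :=
  f ∘ (extChartAt I x).symm

variable [IsManifold I ∞ M]

variable (I) in
/-- The components of the tangent vectors at `q` in the coordinate frame of the preferred chart at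
`x`. -/
abbrev toCoord (x q : M) : TangentSpace I q →L[ℝ] E :=
  (trivializationAt E (TangentSpace I : M → Type _) x).continuousLinearMapAt ℝ q

variable (I) in
/-- The tangent vectors at `q` with given components in the coordinate frame of the preferred chart
at `x`. -/
abbrev ofCoord (x q : M) : E →L[ℝ] TangentSpace I q :=
  (trivializationAt E (TangentSpace I : M → Type _) x).symmL ℝ q

variable {x q : M}

lemma mem_baseSet (hq : q ∈ (extChartAt I x).source) :
    q ∈ (trivializationAt E (TangentSpace I : M → Type _) x).baseSet := by
  simpa using hq

lemma toCoord_ofCoord (hq : q ∈ (extChartAt I x).source) (u : E) :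
    toCoord I x q (ofCoord I x q u) = u :=
  (trivializationAt E (TangentSpace I : M → Type _) x).continuousLinearMapAt_symmL
    (mem_baseSet hq) u

lemma ofCoord_toCoord (hq : q ∈ (extChartAt I x).source) (u : TangentSpace I q) :
    ofCoord I x q (toCoord I x q u) = u :=
  (trivializationAt E (TangentSpace I : M → Type _) x).symmL_continuousLinearMapAt
    (mem_baseSet hq) u

/-- `toCoord` as a linear equivalence. -/
def coordEquiv (hq : q ∈ (extChartAt I x).source) : TangentSpace I q ≃ₗ[ℝ] E :=
  LinearEquiv.ofLinearMap (toCoord I x q).toLinearMap (ofCoord I x q).toLinearMap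
    (LinearMap.ext (toCoord_ofCoord hq)) (LinearMap.ext (ofCoord_toCoord hq))

lemma fieldCoord_eq (Y : Π x : M, TangentSpace I x) (hq : q ∈ (extChartAt I x).source) :
    fieldCoord Y x q = toCoord I x q (Y q) := by
  rw [Bundle.Trivialization.continuousLinearMapAt_apply,
    Bundle.Trivialization.coe_linearMapAt_of_mem _ (mem_baseSet hq)]
  rfl

lemma toCoord_eq_mfderiv (hq : q ∈ (extChartAt I x).source) :
    toCoord I x q = mfderiv I 𝓘(ℝ, E) (extChartAt I x) q :=
  TangentBundle.continuousLinearMapAt_trivializationAt (by simpa using hq)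

lemma mdifferentiableAt_fieldCoord_iff {Y : Π x : M, TangentSpace I x}
    (hq : q ∈ (extChartAt I x).source) : MDiffAt (T% Y) q ↔ MDiffAt (fieldCoord Y x) q :=
  (trivializationAt E (TangentSpace I : M → Type _) x).mdifferentiableAt_section_iff I Y
    (mem_baseSet hq)

section Boundaryless

variable [I.Boundaryless] {V : Type*} [NormedAddCommGroup V] [NormedSpace ℝ V]

lemma eventually_mem_source (hq : q ∈ (extChartAt I x).source) :
    ∀ᶠ q' in 𝓝 q, q' ∈ (extChartAt I x).source :=
  extChartAt_source_mem_nhds' hq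

lemma eventually_mem_target (hq : q ∈ (extChartAt I x).source) :
    ∀ᶠ z in 𝓝 (extChartAt I x q), z ∈ (extChartAt I x).target :=
  (isOpen_extChartAt_target x).mem_nhds ((extChartAt I x).map_source hq)

lemma mdifferentiableAt_extChartAt_symm {z : E} (hz : z ∈ (extChartAt I x).target) :
    MDiffAt (extChartAt I x).symm z :=
  ((contMDiffOn_extChartAt_symm (n := 1) x).contMDiffAt
    ((isOpen_extChartAt_target x).mem_nhds hz)).mdifferentiableAt (by norm_num)

lemma inChart_comp_eventuallyEq (f : M → V) (hq : q ∈ (extChartAt I x).source) :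
    inChart I x f ∘ extChartAt I x =ᶠ[𝓝 q] f := by
  filter_upwards [eventually_mem_source hq] with q' hq'
  exact congrArg f ((extChartAt I x).left_inv hq')

lemma mdifferentiableAt_iff_inChart {f : M → V} (hq : q ∈ (extChartAt I x).source) :
    MDiffAt f q ↔ DifferentiableAt ℝ (inChart I x f) (extChartAt I x q) := by
  constructor
  · intro hf
    rw [← mdifferentiableAt_iff_differentiableAt]
    refine MDifferentiableAt.comp (I' := I) _ ?_
      (mdifferentiableAt_extChartAt_symm ((extChartAt I x).map_source hq))
    rwa [(extChartAt I x).left_inv hq]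
  · intro hf
    refine MDifferentiableAt.congr_of_eventuallyEq ?_ (inChart_comp_eventuallyEq f hq).symm
    exact (mdifferentiableAt_iff_differentiableAt.2 hf).comp q
      (mdifferentiableAt_extChartAt (by simpa using hq))

/-- The chain rule for the chart. No differentiability is required: a function and its chart
expression are differentiable simultaneously, and otherwise both derivatives are zero by convention.
-/
lemma mvfderiv_eq_fderiv_inChart (f : M → V) (hq : q ∈ (extChartAt I x).source)
    (v : TangentSpace I q) :
    d% f q v = fderiv ℝ (inChart I x f) (extChartAt I x q) (toCoord I x q v) := by
  by_cases hf : MDiffAt f q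
  · have hd := (mdifferentiableAt_iff_inChart hq).1 hf
    have h : mfderiv I 𝓘(ℝ, V) (inChart I x f ∘ extChartAt I x) q =
        (mfderiv 𝓘(ℝ, E) 𝓘(ℝ, V) (inChart I x f) (extChartAt I x q)).comp
          (mfderiv I 𝓘(ℝ, E) (extChartAt I x) q) :=
      mfderiv_comp q hd.mdifferentiableAt (mdifferentiableAt_extChartAt (by simpa using hq))
    rw [mfderiv_eq_fderiv, ← toCoord_eq_mfderiv hq] at h
    rw [← mvfderiv_congr (inChart_comp_eventuallyEq f hq)]
    exact congrArg (fun L ↦ L v) h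
  · have hd := mt (mdifferentiableAt_iff_inChart hq).2 hf
    rw [fderiv_zero_of_not_differentiableAt hd, mvfderiv, mfderiv_zero_of_not_mdifferentiableAt hf]
    rfl

lemma contDiffAt_inChart {f : M → V}  (hq : q ∈ (extChartAt I x).source)
    (hf : ContMDiffAt I 𝓘(ℝ, V) ∞ f q) :
    ContDiffAt ℝ ∞ (inChart I x f) (extChartAt I x q) := by
  rw [← contMDiffAt_iff_contDiffAt]
  have h := (contMDiffOn_extChartAt_symm (I := I) (n := ∞) x).contMDiffAt
    ((isOpen_extChartAt_target x).mem_nhds ((extChartAt I x).map_source hq))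
  refine ContMDiffAt.comp (I' := I) _ ?_ h
  rwa [(extChartAt I x).left_inv hq]

end Boundaryless

end Chart

/-! ### The Levi-Civita connection in an arbitrary chart. -/

section ChartConnection

variable {E : Type*} [NormedAddCommGroup E] [NormedSpace ℝ E]
  {H : Type*} [TopologicalSpace H] {I : ModelWithCorners ℝ E H}
  {M : Type*} [TopologicalSpace M] [ChartedSpace H M] [IsManifold I ∞ M]

/-- A smooth field of symmetric nondegenerate bilinear forms. -/
structure IsMetric (g : FormField I M) : Prop where
  smooth : IsSmooth g
  symm : ∀ (x : M) (v w : TangentSpace I x), g x v w = g x w v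
  nondeg : ∀ (x : M) (v : TangentSpace I x), (∀ w, g x w v = 0) → v = 0

/-- An injective map into the dual is bijective by equality of dimensions, and continuity of the
inverse is automatic. -/
lemma isInvertible_of_nondegenerate [FiniteDimensional ℝ E] {B : E →L[ℝ] E →L[ℝ] ℝ}
    (hsymm : ∀ v w, B v w = B w v) (hnd : ∀ v, (∀ w, B w v = 0) → v = 0) : B.IsInvertible := by
  have hinj : Function.Injective B := by
    rw [injective_iff_map_eq_zero]
    intro v hv
    refine hnd v fun w ↦ ?_
    rw [hsymm, hv, zero_apply]
  have hrank : Module.finrank ℝ E = Module.finrank ℝ (E →L[ℝ] ℝ) := by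
    rw [← LinearMap.toContinuousLinearMap.finrank_eq]
    exact Subspace.dual_finrank_eq.symm
  exact ⟨(LinearEquiv.ofInjectiveOfFinrankEq B.toLinearMap hinj hrank).toContinuousLinearEquiv, rfl⟩

variable {x q : M} {g : FormField I M}

lemma IsMetric.isInvertible [FiniteDimensional ℝ E] (hg : IsMetric g) (q : M) :
    (g q).IsInvertible :=
  isInvertible_of_nondegenerate (E := E) (hg.symm q) (hg.nondeg q)

lemma inChart_apply {V : Type*} (f : M → V) (hq : q ∈ (extChartAt I x).source) :
    inChart I x f (extChartAt I x q) = f q :=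
  congrArg f ((extChartAt I x).left_inv hq)

lemma apply_eq_formCoord (T : FormField I M) (hq : q ∈ (extChartAt I x).source)
    (v w : TangentSpace I q) :
    T q v w = formCoord I T x q (toCoord I x q v) (toCoord I x q w) := by
  rw [formCoord, pullbackForm_apply, ofCoord_toCoord hq, ofCoord_toCoord hq]

/-- The trivialisation centred at `x` tests smoothness at every point of its chart domain, so the
components can be differentiated in one fixed chart. -/
lemma contMDiffAt_section_iff_formCoord {T : FormField I M}
    (hq : q ∈ (extChartAt I x).source) :
    ContMDiffAt I (I.prod 𝓘(ℝ, E →L[ℝ] E →L[ℝ] ℝ)) ∞ (fun x ↦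
      (⟨x, T x⟩ : Bundle.TotalSpace (E →L[ℝ] E →L[ℝ] ℝ)
        fun x : M ↦ TangentSpace I x →L[ℝ] TangentSpace I x →L[ℝ] ℝ)) q ↔
      ContMDiffAt I 𝓘(ℝ, E →L[ℝ] E →L[ℝ] ℝ) ∞ (formCoord I T x) q := by
  have hb := mem_baseSet hq
  refine ((trivializationAt (E →L[ℝ] E →L[ℝ] ℝ)
    (fun x : M ↦ TangentSpace I x →L[ℝ] TangentSpace I x →L[ℝ] ℝ) x).contMDiffAt_section_iff
    (IB := I) (n := ∞) (s := T) (x₀ := q) (by simpa using hq)).trans ?_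
  refine Filter.EventuallyEq.contMDiffAt_iff ?_
  filter_upwards [(trivializationAt E (TangentSpace I : M → Type _) x).open_baseSet.mem_nhds hb]
    with q' hq'
  ext v w
  simp only [formCoord, pullbackForm_apply, hom_trivializationAt_apply]
  rw [inCoordinates_apply_eq₂ hq' hq' (by simp)]
  rw [Bundle.Trivialization.symmL_apply _ hq',
    Bundle.Trivialization.symmL_apply _ hq']
  simp

variable [I.Boundaryless]

lemma contDiffAt_formCoord {T : FormField I M} (hT : IsSmooth T)
    (hq : q ∈ (extChartAt I x).source) :
    ContDiffAt ℝ ∞ (inChart I x (formCoord I T x)) (extChartAt I x q) :=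
  contDiffAt_inChart hq ((contMDiffAt_section_iff_formCoord hq).1 (hT q))

lemma IsMetric.isInvertible_formCoord [FiniteDimensional ℝ E] (hg : IsMetric g)
    (hq : q ∈ (extChartAt I x).source) : (formCoord I g x q).IsInvertible := by
  refine isInvertible_of_nondegenerate (fun v w ↦ hg.symm q _ _) fun v hv ↦ ?_
  rw [← toCoord_ofCoord hq v, hg.nondeg q (ofCoord I x q v), map_zero]
  intro w
  rw [apply_eq_formCoord g hq, toCoord_ofCoord hq, hv]

/-- The vector field with constant components `u` in the preferred chart at `x`. -/
abbrev coordField (x : M) (u : E) : Π q : M, TangentSpace I q := fun q ↦ ofCoord I x q u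

lemma fieldCoord_coordField (hq : q ∈ (extChartAt I x).source) (u : E) :
    fieldCoord (coordField (I := I) x u) x =ᶠ[𝓝 q] fun _ ↦ u := by
  filter_upwards [eventually_mem_source hq] with q' hq'
  rw [fieldCoord_eq _ hq', toCoord_ofCoord hq']

lemma mdifferentiableAt_coordField (hq : q ∈ (extChartAt I x).source) (u : E) :
    MDiffAt (T% (coordField (I := I) x u)) q :=
  (mdifferentiableAt_fieldCoord_iff hq).2
    (mdifferentiableAt_const.congr_of_eventuallyEq (fieldCoord_coordField hq u))

lemma ofCoord_eq_mfderiv {z : E} (hz : z ∈ (extChartAt I x).target) :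
    ofCoord I x ((extChartAt I x).symm z) = mfderiv 𝓘(ℝ, E) I (extChartAt I x).symm z := by
  have h := TangentBundle.symmL_trivializationAt (I := I) (x₀ := x)
    (x := (extChartAt I x).symm z) (by simpa using (extChartAt I x).map_target hz)
  rw [(extChartAt I x).right_inv hz, I.range_eq_univ, mfderivWithin_univ] at h
  exact h

/-- Pulled back by the inverse chart, the coordinate fields become constant fields, whose bracket
vanishes; brackets commute with pullback. -/
lemma mlieBracket_coordField [CompleteSpace E] (hq : q ∈ (extChartAt I x).source) (u v : E) :
    VectorField.mlieBracket I (coordField (I := I) x u) (coordField x v) q = 0 := by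
  obtain ⟨z, hz, rfl⟩ : ∃ z ∈ (extChartAt I x).target, (extChartAt I x).symm z = q :=
    ⟨_, (extChartAt I x).map_source hq, (extChartAt I x).left_inv hq⟩
  have : IsManifold I (minSmoothness ℝ 2) M := by
    rw [minSmoothness_of_isRCLikeNormedField]
    infer_instance
  let c : E → Π z : E, TangentSpace 𝓘(ℝ, E) z := fun u _ ↦ u
  have hinv : ∀ z ∈ (extChartAt I x).target,
      (mfderiv 𝓘(ℝ, E) I (extChartAt I x).symm z).IsInvertible := by
    intro z hz
    have h := isInvertible_mfderivWithin_extChartAt_symm (I := I) (x := x) hz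
    rwa [I.range_eq_univ, mfderivWithin_univ] at h
  have hpull : ∀ u, VectorField.mpullback 𝓘(ℝ, E) I (extChartAt I x).symm (coordField (I := I) x u)
      =ᶠ[𝓝 z] c u := by
    intro u
    filter_upwards [(isOpen_extChartAt_target x).mem_nhds hz] with z' hz'
    rw [VectorField.mpullback_apply]
    exact (hinv z' hz').inverse_apply_eq.2 (congrArg (fun L ↦ L u) (ofCoord_eq_mfderiv hz'))
  have h := VectorField.mpullback_mlieBracket (n := 2)
    (mdifferentiableAt_coordField hq u) (mdifferentiableAt_coordField hq v)
    ((contMDiffOn_extChartAt_symm (I := I) (n := 2) x).contMDiffAt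
      ((isOpen_extChartAt_target x).mem_nhds hz))
    (by simp)
  rw [Filter.EventuallyEq.mlieBracket_vectorField_eq (hpull u) (hpull v),
    VectorField.mpullback_apply] at h
  have h0 : VectorField.mlieBracket 𝓘(ℝ, E) (c u) (c v) z = 0 := by
    rw [← VectorField.mlieBracketWithin_univ, VectorField.mlieBracketWithin_eq_lieBracketWithin]
    simp only [VectorField.lieBracketWithin, c, fderivWithin_const_apply]
    exact sub_self _
  rw [h0, (hinv z hz).inverse_apply_eq] at h
  rw [h]
  exact map_zero _

/-- The Christoffel symbols of `g` in the preferred chart at `x`. -/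
abbrev chartChristoffel (g : FormField I M) (x : M) : E → E →L[ℝ] E →L[ℝ] E :=
  christoffelForm (inChart I x (formCoord I g x))

/-- The value at `q` is defined in the preferred chart at `q`, while the Christoffel symbols here
belong to the chart at `x`. Instead of transforming Christoffel symbols, the proof uses that the
connection is torsion-free and metric, and that the Koszul identity then determines it. -/
lemma leviCivita_coordField [FiniteDimensional ℝ E] (hg : IsMetric g)
    (hq : q ∈ (extChartAt I x).source) (u w : E) :
    toCoord I x q (leviCivita g (coordField x w) q (ofCoord I x q u)) =
      chartChristoffel g x (extChartAt I x q) u w := by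
  have : CompleteSpace E := FiniteDimensional.complete ℝ E
  set B : E → E → E := fun u w ↦ toCoord I x q (leviCivita g (coordField x w) q (ofCoord I x q u))
    with hB
  have hgd := (contDiffAt_formCoord hg.smooth hq).differentiableAt (by simp)
  have hval := inChart_apply (formCoord I g x) hq
  -- Zero torsion, combined with the vanishing bracket of coordinate fields.
  have hsymmB : ∀ u w, B u w = B w u := by
    intro u w
    have h := ((leviCivita g).torsion_eq_zero_iff.1 (leviCivita_torsion hg.smooth hg.symm))
      (mdifferentiableAt_coordField hq u) (mdifferentiableAt_coordField hq w)
    rw [mlieBracket_coordField hq, sub_eq_zero] at h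
    exact congrArg (toCoord I x q) h
  have hmet : ∀ u w z, fderiv ℝ (inChart I x (formCoord I g x)) (extChartAt I x q) u w z =
      formCoord I g x q (B u w) z + formCoord I g x q w (B u z) := by
    intro u w z
    have h := leviCivita_metric hg.smooth hg.symm (hg.isInvertible q)
      (mdifferentiableAt_coordField hq w) (mdifferentiableAt_coordField hq z) (ofCoord I x q u)
    rw [mvfderiv_eq_fderiv_inChart _ hq, apply_eq_formCoord g hq, apply_eq_formCoord g hq,
      toCoord_ofCoord hq, toCoord_ofCoord hq, toCoord_ofCoord hq] at h
    rw [fderiv_clm_apply_const₂ hgd]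
    exact h
  have hs : ∀ a b, formCoord I g x q a b = formCoord I g x q b a := fun a b ↦ hg.symm q _ _
  refine christoffelForm_unique ?_ fun z ↦ ?_
  · rw [hval]
    exact hg.isInvertible_formCoord hq
  · rw [hmet, hmet, hmet, hval, hsymmB w u, hsymmB z u, hsymmB z w, hs w, hs u]
    change formCoord I g x q (B u w) z = _
    ring

/-- The Jacobian of the change of coordinates from the preferred chart at `x` to that at `x'`. -/
abbrev transition (I : ModelWithCorners ℝ E H) [IsManifold I ∞ M] (x x' q : M) : E →L[ℝ] E :=
  ((trivializationAt E (TangentSpace I : M → Type _) x).coordChangeL ℝ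
    (trivializationAt E (TangentSpace I : M → Type _) x') q : E →L[ℝ] E)

lemma transition_apply {x' : M} (hq : q ∈ (extChartAt I x).source)
    (hq' : q ∈ (extChartAt I x').source) (a : E) :
    transition I x x' q a = toCoord I x' q (ofCoord I x q a) := by
  refine (Bundle.Trivialization.coordChangeL_apply _ _
    ⟨mem_baseSet hq, mem_baseSet hq'⟩ a).trans ?_
  rw [Bundle.Trivialization.continuousLinearMapAt_apply,
    Bundle.Trivialization.coe_linearMapAt_of_mem _ (mem_baseSet hq'),
    Bundle.Trivialization.symmL_apply _ (mem_baseSet hq)]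

lemma mdifferentiableAt_transition {x' : M} (hq : q ∈ (extChartAt I x).source)
    (hq' : q ∈ (extChartAt I x').source) : MDiffAt (transition I x x') q :=
  mdifferentiableAt_coordChangeL (mem_baseSet hq) (mem_baseSet hq')

lemma fieldCoord_change (Y : Π q : M, TangentSpace I q) {x' : M}
    (hq : q ∈ (extChartAt I x).source) (hq' : q ∈ (extChartAt I x').source) :
    fieldCoord Y x' =ᶠ[𝓝 q] fun p ↦ transition I x x' p (fieldCoord Y x p) := by
  filter_upwards [eventually_mem_source hq, eventually_mem_source hq'] with p hp hp'
  rw [transition_apply hp hp', fieldCoord_eq _ hp, fieldCoord_eq _ hp', ofCoord_toCoord hp]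

/-- Near `q` the field is split as `Z + W`, with `W` constant in the chart at `x` and `Z` zero at
`q`. The first is `leviCivita_coordField`; the derivative of a field at a zero does not depend on
the connection or on the chart. -/
lemma leviCivita_coord [FiniteDimensional ℝ E] (hg : IsMetric g)
    (hq : q ∈ (extChartAt I x).source) {Y : Π q : M, TangentSpace I q} (hY : MDiffAt (T% Y) q)
    (v : TangentSpace I q) :
    toCoord I x q (leviCivita g Y q v) = d% (fieldCoord Y x) q v
      + chartChristoffel g x (extChartAt I x q) (toCoord I x q v) (toCoord I x q (Y q)) := by
  set w := toCoord I x q (Y q) with hw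
  set W : Π q : M, TangentSpace I q := coordField x w with hWdef
  have hW := mdifferentiableAt_coordField (I := I) hq w
  obtain ⟨Z, hZ⟩ : ∃ Z : Π q : M, TangentSpace I q, Z = Y - W := ⟨_, rfl⟩
  have hYZ : Y = Z + W := by rw [hZ, sub_add_cancel]
  have hZd : MDiffAt (T% Z) q := by rw [hZ]; exact mdifferentiableAt_sub_section hY hW
  have hZ0 : Z q = 0 := by
    rw [hZ, Pi.sub_apply, hWdef, hw]
    simp only [coordField]
    rw [ofCoord_toCoord hq, sub_self]
  have hqq : q ∈ (extChartAt I q).source := mem_extChartAt_source q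
  have hadd : leviCivita g Y q v = leviCivita g Z q v + leviCivita g W q v := by
    rw [hYZ, (leviCivita g).isCovariantDerivativeOn.add hZd hW]
    rfl
  have hfc : d% (fieldCoord Y x) q v = d% (fieldCoord Z x) q v := by
    have h : fieldCoord Y x =ᶠ[𝓝 q] fieldCoord Z x + fun _ ↦ w := by
      filter_upwards [eventually_mem_source hq] with q' hq'
      rw [fieldCoord_eq _ hq', Pi.add_apply, fieldCoord_eq _ hq', hYZ, Pi.add_apply,
        map_add, hWdef, toCoord_ofCoord hq']
    rw [mvfderiv_congr h, mvfderiv_add ((mdifferentiableAt_fieldCoord_iff hq).1 hZd)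
      mdifferentiableAt_const, mvfderiv_const, add_zero]
  have hZD : toCoord I x q (leviCivita g Z q v) = d% (fieldCoord Z x) q v := by
    have hk : koszul g q (Z q) = 0 := by
      rw [hZ0]
      ext a b
      simp [koszul_apply]
    -- In the change from the chart at `q` to the chart at `x`, the derivative of the transition map
    -- is applied to this zero vector.
    have hZc : fieldCoord Z q q = 0 := by rw [fieldCoord_eq _ hqq, hZ0, map_zero]
    rw [leviCivita_apply, hk, zero_apply, map_zero, add_zero,
      mvfderiv_congr (fieldCoord_change Z hqq hq),
      mvfderiv_clm_apply (mdifferentiableAt_transition hqq hq)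
        ((mdifferentiableAt_fieldCoord_iff hqq).1 hZd), hZc, map_zero, zero_add,
      transition_apply hqq hq]
  have hWD : leviCivita g W q v = leviCivita g W q (ofCoord I x q (toCoord I x q v)) := by
    rw [ofCoord_toCoord hq]
  rw [hadd, map_add, hZD, hfc, hWD, leviCivita_coordField hg hq]

end ChartConnection

/-! ### Covariant derivatives of tensors and curvature in a chart. -/

section ChartTensors

variable {E : Type*} [NormedAddCommGroup E] [NormedSpace ℝ E] [FiniteDimensional ℝ E]
  {H : Type*} [TopologicalSpace H] {I : ModelWithCorners ℝ E H} [I.Boundaryless]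
  {M : Type*} [TopologicalSpace M] [ChartedSpace H M] [IsManifold I ∞ M]
  {x q : M} {g T : FormField I M}

lemma inChart_comp_extChartAt_eventuallyEq {V : Type*} (K : E → V)
    (hq : q ∈ (extChartAt I x).source) :
    inChart I x (fun p ↦ K (extChartAt I x p)) =ᶠ[𝓝 (extChartAt I x q)] K := by
  filter_upwards [eventually_mem_target hq] with z hz
  exact congrArg K ((extChartAt I x).right_inv hz)

lemma covDeriv_coord (hg : IsMetric g) (hT : IsSmooth T) (hq : q ∈ (extChartAt I x).source)
    (w a b : TangentSpace I q) :
    covDeriv (leviCivita g) T q w a b =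
      covDerivForm (chartChristoffel g x) (inChart I x (formCoord I T x)) (extChartAt I x q)
        (toCoord I x q w) (toCoord I x q a) (toCoord I x q b) := by
  set A : Π q : M, TangentSpace I q := FiberBundle.extend E a with hA
  set B : Π q : M, TangentSpace I q := FiberBundle.extend E b with hB
  have hAd : MDiffAt (T% A) q := FiberBundle.mdifferentiableAt_extend I E a
  have hBd : MDiffAt (T% B) q := FiberBundle.mdifferentiableAt_extend I E b
  have hAq : A q = a := FiberBundle.extend_apply_self ..
  have hBq : B q = b := FiberBundle.extend_apply_self ..
  have hAc := (mdifferentiableAt_fieldCoord_iff hq).1 hAd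
  have hBc := (mdifferentiableAt_fieldCoord_iff hq).1 hBd
  have hTc : MDiffAt (formCoord I T x) q :=
    ((contMDiffAt_section_iff_formCoord hq).1 (hT q)).mdifferentiableAt (by simp)
  have h : (fun p ↦ T p (A p) (B p)) =ᶠ[𝓝 q]
      fun p ↦ formCoord I T x p (fieldCoord A x p) (fieldCoord B x p) := by
    filter_upwards [eventually_mem_source hq] with p hp
    rw [apply_eq_formCoord T hp, fieldCoord_eq _ hp, fieldCoord_eq _ hp]
  rw [covDeriv, mvfderiv_congr h, mvfderiv_clm_apply (hTc.clm_apply hAc) hBc,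
    mvfderiv_clm_apply hTc hAc, covDerivForm_apply, apply_eq_formCoord T hq,
    apply_eq_formCoord T hq, leviCivita_coord hg hq hAd, leviCivita_coord hg hq hBd,
    mvfderiv_eq_fderiv_inChart (formCoord I T x) hq, inChart_apply _ hq, fieldCoord_eq _ hq,
    fieldCoord_eq _ hq, hAq, hBq]
  simp only [map_add, add_apply]
  ring

/-- The standard extension of a vector at `x` has constant components in the preferred chart at `x`.
This is why the second-order objects below are computed at the centre of the chart, while
first-order ones are available on its whole domain. -/
lemma toCoord_extend_eventuallyEq (w : TangentSpace I x) :
    (fun p ↦ toCoord I x p (FiberBundle.extend E w p)) =ᶠ[𝓝 x] fun _ ↦ toCoord I x x w := by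
  filter_upwards [fieldCoord_extend w, eventually_mem_source (mem_extChartAt_source (I := I) x)]
    with p hp hps
  have h := fieldCoord_eq (FiberBundle.extend E w) (mem_extChartAt_source (I := I) x)
  rw [FiberBundle.extend_apply_self] at h
  rw [← fieldCoord_eq _ hps, hp, ← h, (fieldCoord_extend w).self_of_nhds]

lemma leviCivita_extend_coord (hg : IsMetric g) (w : TangentSpace I x) :
    ∀ᶠ p in 𝓝 x, ∀ v, toCoord I x p (leviCivita g (FiberBundle.extend E w) p v) =
      chartChristoffel g x (extChartAt I x p) (toCoord I x p v) (toCoord I x x w) := by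
  filter_upwards [(fieldCoord_extend w).eventually_nhds, toCoord_extend_eventuallyEq w,
    eventually_mem_source (mem_extChartAt_source (I := I) x)] with p hp hw hps v
  have hd : MDiffAt (T% (FiberBundle.extend E w : Π q : M, TangentSpace I q)) p :=
    (mdifferentiableAt_fieldCoord_iff hps).2 (mdifferentiableAt_const.congr_of_eventuallyEq hp)
  rw [leviCivita_coord hg hps hd, hw, mvfderiv_congr hp, mvfderiv_const, zero_apply, zero_add]

lemma secondCovDeriv_coord (hg : IsMetric g) (hT : IsSmooth T) (v w a b : TangentSpace I x) :
    secondCovDeriv (leviCivita g) T x v w a b =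
      secondCovDerivForm (chartChristoffel g x) (inChart I x (formCoord I T x)) (extChartAt I x x)
        (toCoord I x x v) (toCoord I x x w) (toCoord I x x a) (toCoord I x x b) := by
  have : CompleteSpace E := FiniteDimensional.complete ℝ E
  have hx := mem_extChartAt_source (I := I) x
  have h : (fun q ↦ covDeriv (leviCivita g) T q (FiberBundle.extend E w q)
      (FiberBundle.extend E a q) (FiberBundle.extend E b q)) =ᶠ[𝓝 x] fun q ↦
      covDerivForm (chartChristoffel g x) (inChart I x (formCoord I T x)) (extChartAt I x q)
        (toCoord I x x w) (toCoord I x x a) (toCoord I x x b) := by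
    filter_upwards [eventually_mem_source hx, toCoord_extend_eventuallyEq w,
      toCoord_extend_eventuallyEq a, toCoord_extend_eventuallyEq b] with p hp hw ha hb
    rw [covDeriv_coord hg hT hp, hw, ha, hb]
  have hΓ : DifferentiableAt ℝ (chartChristoffel g x) (extChartAt I x x) :=
    differentiableAt_christoffelForm ((contDiffAt_formCoord hg.smooth hx).of_le ENat.LEInfty.out) (by
      rw [inChart_apply _ hx]
      exact hg.isInvertible_formCoord hx)
  have hT2 := (contDiffAt_formCoord hT hx).of_le (m := 2) ENat.LEInfty.out
  have hD := fun w ↦ (leviCivita_extend_coord hg w).self_of_nhds v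
  rw [secondCovDeriv, mvfderiv_congr h, mvfderiv_eq_fderiv_inChart _ hx,
    (inChart_comp_extChartAt_eventuallyEq (fun z ↦ covDerivForm (chartChristoffel g x)
      (inChart I x (formCoord I T x)) z (toCoord I x x w) (toCoord I x x a) (toCoord I x x b))
      hx).fderiv_eq, ← fderiv_clm_apply_const₃ (differentiableAt_covDerivForm hΓ hT2),
    covDeriv_coord hg hT hx, covDeriv_coord hg hT hx, covDeriv_coord hg hT hx, hD, hD, hD,
    secondCovDerivForm]

lemma curvatureVector_coord (hg : IsMetric g) (u v w : TangentSpace I x) :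
    toCoord I x x (curvatureVector (leviCivita g) x u v w) =
      curvatureForm (chartChristoffel g x) (extChartAt I x x)
        (toCoord I x x u) (toCoord I x x v) (toCoord I x x w) := by
  have : CompleteSpace E := FiniteDimensional.complete ℝ E
  have hx := mem_extChartAt_source (I := I) x
  have hΓ : DifferentiableAt ℝ (chartChristoffel g x) (extChartAt I x x) :=
    differentiableAt_christoffelForm ((contDiffAt_formCoord hg.smooth hx).of_le ENat.LEInfty.out) (by
      rw [inChart_apply _ hx]
      exact hg.isInvertible_formCoord hx)
  have key : ∀ u v : TangentSpace I x, toCoord I x x (leviCivita g (fun q ↦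
      leviCivita g (FiberBundle.extend E w) q (FiberBundle.extend E v q)) x u) =
      fderiv ℝ (chartChristoffel g x) (extChartAt I x x) (toCoord I x x u) (toCoord I x x v)
        (toCoord I x x w) + chartChristoffel g x (extChartAt I x x) (toCoord I x x u)
        (chartChristoffel g x (extChartAt I x x) (toCoord I x x v) (toCoord I x x w)) := by
    intro u v
    set Z : Π q : M, TangentSpace I q := fun q ↦
      leviCivita g (FiberBundle.extend E w) q (FiberBundle.extend E v q) with hZ
    have h : fieldCoord Z x =ᶠ[𝓝 x] fun q ↦ chartChristoffel g x (extChartAt I x q)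
        (toCoord I x x v) (toCoord I x x w) := by
      filter_upwards [eventually_mem_source hx, leviCivita_extend_coord hg w,
        toCoord_extend_eventuallyEq v] with p hp hw hv
      rw [fieldCoord_eq _ hp, hZ, hw, hv]
    have hK := inChart_comp_extChartAt_eventuallyEq (I := I) (fun z ↦ chartChristoffel g x z
      (toCoord I x x v) (toCoord I x x w)) hx
    have hd : MDiffAt (T% Z) x := by
      refine (mdifferentiableAt_fieldCoord_iff hx).2 (MDifferentiableAt.congr_of_eventuallyEq ?_ h)
      refine (mdifferentiableAt_iff_inChart hx).2 (DifferentiableAt.congr_of_eventuallyEq ?_ hK)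
      fun_prop
    rw [leviCivita_coord hg hx hd, ← fieldCoord_eq _ hx, h.self_of_nhds, mvfderiv_congr h,
      mvfderiv_eq_fderiv_inChart _ hx, hK.fderiv_eq, ← fderiv_clm_apply_const₂ hΓ]
  rw [curvatureVector]
  simp only [mlieBracket_extend, map_zero, sub_zero, map_sub, key, curvatureForm]

end ChartTensors

/-! ### Maps, restricted tensors and the second fundamental form in a pair of charts. -/

section ChartMaps

variable {E : Type*} [NormedAddCommGroup E] [NormedSpace ℝ E]
  {H : Type*} [TopologicalSpace H] {I : ModelWithCorners ℝ E H} [I.Boundaryless]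
  {M : Type*} [TopologicalSpace M] [ChartedSpace H M] [IsManifold I ∞ M]
  {E' : Type*} [NormedAddCommGroup E'] [NormedSpace ℝ E']
  {H' : Type*} [TopologicalSpace H'] {I' : ModelWithCorners ℝ E' H'} [I'.Boundaryless]
  {M' : Type*} [TopologicalSpace M'] [ChartedSpace H' M'] [IsManifold I' ∞ M']
  {x q : M} {x' : M'} {F : M → M'}

variable (I I') in
/-- The map `F` in the preferred charts at `x` and `x'`. -/
abbrev mapInChart (x : M) (x' : M') (F : M → M') : E → E' :=
  inChart I x fun q ↦ extChartAt I' x' (F q)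

lemma contDiffAt_mapInChart (hF : ContMDiff I I' ∞ F) (hq : q ∈ (extChartAt I x).source)
    (hq' : F q ∈ (extChartAt I' x').source) :
    ContDiffAt ℝ ∞ (mapInChart I I' x x' F) (extChartAt I x q) :=
  contDiffAt_inChart hq
    ((contMDiffAt_extChartAt' (by simpa using hq')).comp q hF.contMDiffAt)

lemma mapInChart_apply (hq : q ∈ (extChartAt I x).source) :
    mapInChart I I' x x' F (extChartAt I x q) = extChartAt I' x' (F q) :=
  inChart_apply _ hq

lemma toCoord_mfderiv (hF : MDiffAt F q) (hq : q ∈ (extChartAt I x).source)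
    (hq' : F q ∈ (extChartAt I' x').source) (v : TangentSpace I q) :
    toCoord I' x' (F q) (mfderiv I I' F q v) =
      fderiv ℝ (mapInChart I I' x x' F) (extChartAt I x q) (toCoord I x q v) := by
  rw [← mvfderiv_eq_fderiv_inChart _ hq, toCoord_eq_mfderiv hq']
  exact (congrArg (fun L ↦ L v) (mfderiv_comp q
    (mdifferentiableAt_extChartAt (by simpa using hq')) hF)).symm

lemma eventually_map_mem_source (hF : ContinuousAt F q) (hq' : F q ∈ (extChartAt I' x').source) :
    ∀ᶠ p in 𝓝 q, F p ∈ (extChartAt I' x').source :=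
  hF.eventually (eventually_mem_source hq')

lemma formCoord_restrictForm (T : FormField I' M') (hF : MDiffAt F q)
    (hq : q ∈ (extChartAt I x).source) (hq' : F q ∈ (extChartAt I' x').source) (u w : E) :
    formCoord I (restrictForm I F T) x q u w = formCoord I' T x' (F q)
      (fderiv ℝ (mapInChart I I' x x' F) (extChartAt I x q) u)
      (fderiv ℝ (mapInChart I I' x x' F) (extChartAt I x q) w) := by
  rw [formCoord, pullbackForm_apply, restrictForm, pullbackForm_apply, apply_eq_formCoord T hq',
    toCoord_mfderiv hF hq hq', toCoord_mfderiv hF hq hq', toCoord_ofCoord hq, toCoord_ofCoord hq]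

lemma isSmooth_restrictForm {T : FormField I' M'} (hT : IsSmooth T) (hF : ContMDiff I I' ∞ F) :
    IsSmooth (restrictForm I F T) := by
  intro q
  have hq := mem_extChartAt_source (I := I) q
  have hq' := mem_extChartAt_source (I := I') (F q)
  rw [contMDiffAt_section_iff_formCoord hq]
  set f := mapInChart I I' q (F q) F
  have hf : ContDiffAt ℝ ∞ f (extChartAt I q q) := contDiffAt_mapInChart hF hq hq'
  have hf' : ContDiffAt ℝ ∞ (fderiv ℝ f) (extChartAt I q q) := hf.fderiv_right (by simp)
  have hTf : ContMDiffAt I 𝓘(ℝ, E' →L[ℝ] E' →L[ℝ] ℝ) ∞ (fun p ↦ formCoord I' T (F q) (F p)) q :=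
    ((contMDiffAt_section_iff_formCoord hq').1 (hT (F q))).comp q hF.contMDiffAt
  have hA : ContMDiffAt I 𝓘(ℝ, E →L[ℝ] E') ∞ (fun p ↦ fderiv ℝ f (extChartAt I q p)) q :=
    hf'.contMDiffAt.comp q (contMDiffAt_extChartAt' (by simp))
  have hP : ContMDiffAt I 𝓘(ℝ, (E' →L[ℝ] ℝ) →L[ℝ] (E →L[ℝ] ℝ)) ∞
      (fun p ↦ (ContinuousLinearMap.compL ℝ E E' ℝ).flip (fderiv ℝ f (extChartAt I q p))) q :=
    contMDiffAt_const.clm_apply hA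
  refine (hP.clm_comp (hTf.clm_comp hA)).congr_of_eventuallyEq ?_
  filter_upwards [eventually_mem_source hq,
    eventually_map_mem_source hF.continuous.continuousAt hq'] with p hp hp'
  ext u w
  rw [formCoord_restrictForm T (hF.mdifferentiableAt (by simp)) hp hp']
  rfl

variable [FiniteDimensional ℝ E']

/-- The definition uses the preferred chart at `F q`, which moves with `q`. Passing to the fixed
chart at `x'` produces two terms with derivatives of the transition maps, one from the components of
`Z` and one from the extended vector, and they cancel. -/
lemma covDerivAlong_coord {g : FormField I' M'} (hg : IsMetric g) (hF : MDiffAt F q)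
    (hq' : F q ∈ (extChartAt I' x').source) {Z : Π p : M, TangentSpace I' (F p)}
    (hZ : MDiffAt (fun p ↦ toCoord I' x' (F p) (Z p)) q) (v : TangentSpace I q) :
    toCoord I' x' (F q) (covDerivAlong (leviCivita g) F Z q v) =
      d% (fun p ↦ toCoord I' x' (F p) (Z p)) q v
        + chartChristoffel g x' (extChartAt I' x' (F q))
          (toCoord I' x' (F q) (mfderiv I I' F q v)) (toCoord I' x' (F q) (Z q)) := by
  have hqq : F q ∈ (extChartAt I' (F q)).source := mem_extChartAt_source (F q)
  set ζ : M → E' := fun p ↦ toCoord I' x' (F p) (Z p) with hζ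
  set τ := transition I' x' (F q) with hτ
  set σ := transition I' (F q) x' with hσ
  have hτd : MDiffAt τ (F q) := mdifferentiableAt_transition hq' hqq
  have hσd : MDiffAt σ (F q) := mdifferentiableAt_transition hqq hq'
  have hτF : MDiffAt (fun p ↦ τ (F p)) q := hτd.comp q hF
  have h1 : (fun p ↦ (trivializationAt E' (TangentSpace I' : M' → Type _) (F q) ⟨F p, Z p⟩).2)
      =ᶠ[𝓝 q] fun p ↦ τ (F p) (ζ p) := by
    filter_upwards [eventually_map_mem_source hF.continuousAt hq',
      eventually_map_mem_source hF.continuousAt hqq] with p hp hp'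
    rw [hτ, transition_apply hp hp', hζ, ofCoord_toCoord hp,
      Bundle.Trivialization.continuousLinearMapAt_apply,
      Bundle.Trivialization.coe_linearMapAt_of_mem _ (mem_baseSet hp')]
  set Y : Π r : M', TangentSpace I' r := FiberBundle.extend E' (Z q) with hY
  have hYd : MDiffAt (T% Y) (F q) := FiberBundle.mdifferentiableAt_extend I' E' (Z q)
  have hYq : Y (F q) = Z q := FiberBundle.extend_apply_self ..
  have hz : τ (F q) (ζ q) = toCoord I' (F q) (F q) (Z q) := by
    rw [hτ, transition_apply hq' hqq, hζ, ofCoord_toCoord hq']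
  -- The extension is constant in the chart at `F q`, so in the chart at `x'` its components are the
  -- transition map applied to a fixed vector.
  have h2 : fieldCoord Y x' =ᶠ[𝓝 (F q)] fun r ↦ σ r (τ (F q) (ζ q)) := by
    have h := fieldCoord_extend (Z q)
    filter_upwards [fieldCoord_change Y hqq hq', h] with r hr hr'
    have h' := fieldCoord_eq Y hqq
    rw [hYq] at h'
    have h0 : fieldCoord (FiberBundle.extend E' (Z q)) (F q) (F q) =
        (trivializationAt E' (TangentSpace I' : M' → Type _) (F q) ⟨F q, Z q⟩).2 := h.self_of_nhds
    rw [hr, hr', ← h0, hz, ← h']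
  have hcomp : d% (fun p ↦ τ (F p)) q v = d% τ (F q) (mfderiv I I' F q v) :=
    congrArg (fun L ↦ L v) (mfderiv_comp q hτd hF)
  -- Differentiate the identity that the two transition maps are mutually inverse.
  have hστ : ∀ u : TangentSpace I' (F q), d% σ (F q) u (τ (F q) (ζ q))
      + σ (F q) (d% τ (F q) u (ζ q)) = 0 := by
    intro u
    have h : (fun r ↦ σ r (τ r (ζ q))) =ᶠ[𝓝 (F q)] fun _ ↦ ζ q := by
      filter_upwards [eventually_mem_source hq', eventually_mem_source hqq] with r hr hr'
      rw [hσ, hτ, transition_apply hr' hr, transition_apply hr hr', ofCoord_toCoord hr',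
        toCoord_ofCoord hr]
    have h' := congrArg (fun L ↦ L u) (mvfderiv_congr h)
    simp only [mvfderiv_const] at h'
    rw [mvfderiv_clm_apply hσd (hτd.clm_apply mdifferentiableAt_const),
      mvfderiv_clm_apply hτd mdifferentiableAt_const, mvfderiv_const] at h'
    simpa using h'
  have h3 : toCoord I' x' (F q) (leviCivita g Y (F q) (mfderiv I I' F q v)) =
      d% σ (F q) (mfderiv I I' F q v) (τ (F q) (ζ q))
      + chartChristoffel g x' (extChartAt I' x' (F q))
          (toCoord I' x' (F q) (mfderiv I I' F q v)) (toCoord I' x' (F q) (Z q)) := by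
    rw [leviCivita_coord hg hq' hYd, mvfderiv_congr h2, mvfderiv_clm_apply hσd
      mdifferentiableAt_const, mvfderiv_const, hYq]
    simp
  have h4 : ∀ a, toCoord I' x' (F q) (ofCoord I' (F q) (F q) a) = σ (F q) a := fun a ↦
    (transition_apply hqq hq' a).symm
  rw [covDerivAlong, mvfderiv_congr h1, mvfderiv_clm_apply hτF hZ, map_add, h3, hcomp]
  have h5 := hστ (mfderiv I I' F q v)
  have h6 : σ (F q) (τ (F q) (d% ζ q v)) = d% ζ q v := by
    rw [hσ, hτ, transition_apply hqq hq', transition_apply hq' hqq, ofCoord_toCoord hqq,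
      toCoord_ofCoord hq']
  rw [h4, map_add, h6]
  rw [eq_neg_of_add_eq_zero_left h5]
  abel

lemma secondFundamentalForm_coord [FiniteDimensional ℝ E] {g : FormField I' M'} (hg : IsMetric g)
    (hF : ContMDiff I I' ∞ F) (hgF : IsMetric (restrictForm I F g))
    (hq : q ∈ (extChartAt I x).source) (hq' : F q ∈ (extChartAt I' x').source)
    (a b : TangentSpace I q) :
    toCoord I' x' (F q) (secondFundamentalForm g F q a b) =
      sffForm (chartChristoffel g x') (chartChristoffel (restrictForm I F g) x)
        (mapInChart I I' x x' F) (extChartAt I x q) (toCoord I x q a) (toCoord I x q b) := by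
  set B : Π p : M, TangentSpace I p := FiberBundle.extend E b with hB
  have hBd : MDiffAt (T% B) q := FiberBundle.mdifferentiableAt_extend I E b
  have hBq : B q = b := FiberBundle.extend_apply_self ..
  have hBc := (mdifferentiableAt_fieldCoord_iff hq).1 hBd
  have hFd : ∀ p, MDiffAt F p := fun p ↦ hF.mdifferentiableAt (by simp)
  set f := mapInChart I I' x x' F with hf
  have hf' : DifferentiableAt ℝ (fderiv ℝ f) (extChartAt I x q) :=
    (((contDiffAt_mapInChart hF hq hq').of_le (m := 2) ENat.LEInfty.out).fderiv_right (m := 1)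
      (by norm_num)).differentiableAt (by norm_num)
  have hfq : f (extChartAt I x q) = extChartAt I' x' (F q) := mapInChart_apply hq
  have hK := inChart_comp_extChartAt_eventuallyEq (I := I) (fderiv ℝ f) hq
  have hA : MDiffAt (fun p ↦ fderiv ℝ f (extChartAt I x p)) q :=
    (mdifferentiableAt_iff_inChart hq).2 (hf'.congr_of_eventuallyEq hK)
  have h : (fun p ↦ toCoord I' x' (F p) (mfderiv I I' F p (B p))) =ᶠ[𝓝 q]
      fun p ↦ fderiv ℝ f (extChartAt I x p) (fieldCoord B x p) := by
    filter_upwards [eventually_mem_source hq,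
      eventually_map_mem_source hF.continuous.continuousAt hq'] with p hp hp'
    rw [toCoord_mfderiv (hFd p) hp hp', fieldCoord_eq _ hp]
  rw [secondFundamentalForm, map_sub, covDerivAlong_coord hg (hFd q) hq'
    ((hA.clm_apply hBc).congr_of_eventuallyEq h), mvfderiv_congr h, mvfderiv_clm_apply hA hBc,
    mvfderiv_eq_fderiv_inChart _ hq, hK.fderiv_eq, toCoord_mfderiv (hFd q) hq hq',
    toCoord_mfderiv (hFd q) hq hq', toCoord_mfderiv (hFd q) hq hq', leviCivita_coord hgF hq hBd,
    sffForm_apply, fieldCoord_eq _ hq, hBq, hfq, map_add]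
  abel

end ChartMaps

/-! ### The traced identity in coordinates. -/

section Coordinates

set_option maxSynthPendingDepth 4

variable {E E' : Type*} [NormedAddCommGroup E] [NormedSpace ℝ E]
  [NormedAddCommGroup E'] [NormedSpace ℝ E']
  {ι κ : Type*} [Fintype ι] [DecidableEq ι] [Fintype κ] [DecidableEq κ]

lemma eq_zero_of_isInvertible {B : E →L[ℝ] E →L[ℝ] ℝ} (hsymm : ∀ v w, B v w = B w v)
    (hB : B.IsInvertible) (v : E) (hv : ∀ w, B w v = 0) : v = 0 := by
  refine (injective_iff_map_eq_zero B).1 hB.injective v ?_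
  ext w
  rw [hsymm, hv, zero_apply]

lemma sum_sffForm_eq_zero [FiniteDimensional ℝ E] {Γ' : E' → E' →L[ℝ] E' →L[ℝ] E'}
    {Γ : E → E →L[ℝ] E →L[ℝ] E} {f : E → E'} {y : E} {B : E →L[ℝ] E →L[ℝ] ℝ}
    (hsymm : ∀ v w, B v w = B w v) (hnd : ∀ v, (∀ w, B w v = 0) → v = 0)
    (hH : metricTrace B (fun v w ↦ sffForm Γ' Γ f y v w) = 0)
    (e : Module.Basis ι ℝ E) (he : ∀ k l, B (e k) (e l) = if k = l then 1 else 0) :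
    ∑ l, sffForm Γ' Γ f y (e l) (e l) = 0 :=
  (metricTrace_eq_sum_of_orthonormal hsymm hnd e he (sffLin Γ' Γ f y)).symm.trans hH

/-- The trace of the second covariant derivative of the restriction of a `(0,2)`-tensor field to a
submanifold of zero mean curvature, in coordinates. -/
lemma sum_secondCovDerivForm_pullback [FiniteDimensional ℝ E] [FiniteDimensional ℝ E']
    {f : E → E'} {y : E} {g' T : E' → E' →L[ℝ] E' →L[ℝ] ℝ} {g S : E → E →L[ℝ] E →L[ℝ] ℝ}
    (hf : ContDiffAt ℝ 3 f y) (hg' : ContDiffAt ℝ 2 g' (f y)) (hg : ContDiffAt ℝ 2 g y)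
    (hg'_symm : ∀ᶠ z in 𝓝 (f y), ∀ v w, g' z v w = g' z w v)
    (hg'_inv : ∀ᶠ z in 𝓝 (f y), (g' z).IsInvertible) (hg_inv : ∀ᶠ z in 𝓝 y, (g z).IsInvertible)
    (hgg' : ∀ᶠ z in 𝓝 y, ∀ a b, g z a b = g' (f z) (fderiv ℝ f z a) (fderiv ℝ f z b))
    (hT : ContDiffAt ℝ 2 T (f y)) (hS : ContDiffAt ℝ 2 S y)
    (hST : ∀ᶠ z in 𝓝 y, ∀ a b, S z a b = T (f z) (fderiv ℝ f z a) (fderiv ℝ f z b))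
    (hH : ∀ᶠ z in 𝓝 y, metricTrace (g z)
      (fun v w ↦ sffForm (christoffelForm g') (christoffelForm g) f z v w) = 0)
    (e : Module.Basis ι ℝ E) (he : ∀ k l, g y (e k) (e l) = if k = l then 1 else 0)
    (b : Module.Basis κ ℝ E') (u v : E) :
    let Γ' := christoffelForm g'
    let A := fderiv ℝ f y
    let B := sffForm Γ' (christoffelForm g) f y
    let R := curvatureForm Γ' (f y)
    let σ := (Matrix.of fun i j ↦ g' (f y) (b i) (b j))⁻¹
    ∑ l, secondCovDerivForm (christoffelForm g) S y (e l) (e l) u v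
      = ∑ l, secondCovDerivForm Γ' T (f y) (A (e l)) (A (e l)) (A u) (A v)
        + 2 * ∑ l, covDerivForm Γ' T (f y) (A (e l)) (B (e l) u) (A v)
        + 2 * ∑ l, covDerivForm Γ' T (f y) (A (e l)) (A u) (B (e l) v)
        + 2 * ∑ l, T (f y) (B (e l) u) (B (e l) v)
        - ∑ k, ∑ l, g' (f y) (B (e l) u) (B (e l) (e k)) * T (f y) (A (e k)) (A v)
        - ∑ k, ∑ l, g' (f y) (B (e l) v) (B (e l) (e k)) * T (f y) (A u) (A (e k))
        - ∑ i, ∑ j, ∑ l, σ i j * -g' (f y) (R (A (e l)) (A u) (A (e l))) (b i)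
            * T (f y) (b j) (A v)
        - ∑ i, ∑ j, ∑ l, σ i j * -g' (f y) (R (A (e l)) (A v) (A (e l))) (b i)
            * T (f y) (A u) (b j)
        + ∑ k, ∑ l, -g' (f y) (R (A (e l)) (A u) (A (e l))) (A (e k)) * T (f y) (A (e k)) (A v)
        + ∑ k, ∑ l, -g' (f y) (R (A (e l)) (A v) (A (e l))) (A (e k))
            * T (f y) (A u) (A (e k)) := by
  intro Γ' A B R σ
  have : CompleteSpace E := FiniteDimensional.complete ℝ E
  have : CompleteSpace E' := FiniteDimensional.complete ℝ E'
  have hg_symm : ∀ᶠ z in 𝓝 y, ∀ v w, g z v w = g z w v := by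
    filter_upwards [hgg', hf.continuousAt.eventually hg'_symm] with z hz hz' v w
    rw [hz, hz, hz']
  have hΓ' : DifferentiableAt ℝ Γ' (f y) := differentiableAt_christoffelForm hg' hg'_inv.self_of_nhds
  have hΓ : DifferentiableAt ℝ (christoffelForm g) y :=
    differentiableAt_christoffelForm hg hg_inv.self_of_nhds
  have hg'd : ∀ᶠ z in 𝓝 (f y), DifferentiableAt ℝ g' z := by
    filter_upwards [hg'.eventually (by simp)] with z hz using hz.differentiableAt (by norm_num)
  have hgd : ∀ᶠ z in 𝓝 y, DifferentiableAt ℝ g z := by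
    filter_upwards [hg.eventually (by simp)] with z hz using hz.differentiableAt (by norm_num)
  have hΓ'_symm : ∀ᶠ z in 𝓝 (f y), ∀ v w, Γ' z v w = Γ' z w v := by
    filter_upwards [hg'd, hg'_symm.eventually_nhds, hg'_inv] with z h1 h2 h3
    exact christoffelForm_symm h1 h2 h3
  have hΓ_symm : ∀ᶠ z in 𝓝 y, ∀ v w, christoffelForm g z v w = christoffelForm g z w v := by
    filter_upwards [hgd, hg_symm.eventually_nhds, hg_inv] with z h1 h2 h3
    exact christoffelForm_symm h1 h2 h3
  have hc' : ∀ᶠ z in 𝓝 (f y), covDerivForm Γ' g' z = 0 := by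
    filter_upwards [hg'd, hg'_symm.eventually_nhds, hg'_inv] with z h1 h2 h3
    exact covDerivForm_christoffelForm h1 h2 h3
  have hc : ∀ᶠ z in 𝓝 y, covDerivForm (christoffelForm g) g z = 0 := by
    filter_upwards [hgd, hg_symm.eventually_nhds, hg_inv] with z h1 h2 h3
    exact covDerivForm_christoffelForm h1 h2 h3
  have hg_nd : ∀ᶠ z in 𝓝 y, ∀ v, (∀ w, g z w v = 0) → v = 0 := by
    filter_upwards [hg_symm, hg_inv] with z h1 h2 using eq_zero_of_isInvertible h1 h2
  have hB := sum_sffForm_eq_zero hg_symm.self_of_nhds hg_nd.self_of_nhds hH.self_of_nhds e he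
  have key := apply_sum_covDerivSff hΓ' hΓ hf (hg'.of_le (by norm_num)) (hg.of_le (by norm_num))
    hΓ'_symm hΓ_symm hg'_symm hgg'
    (eq_zero_of_isInvertible hg'_symm.self_of_nhds hg'_inv.self_of_nhds) hg_nd hc' hc hH e he b
  -- The divergence formula is applied to the two linear functionals obtained by fixing one argument
  -- of `T`.
  have hu := key u ((T (f y)).flip (A v))
  have hv := key v (T (f y) (A u))
  -- The derivative of `T` in the direction of the mean curvature vector.
  have h0 : ∑ l, covDerivForm Γ' T (f y) (B (e l) (e l)) (A u) (A v) = 0 := by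
    have h := congrArg (fun w ↦ covDerivForm Γ' T (f y) w (A u) (A v)) hB
    simpa [map_sum] using h
  simp only [ContinuousLinearMap.flip_apply] at hu
  simp only [secondCovDerivForm_pullback hΓ' hΓ hf hT hS hST, Finset.sum_add_distrib]
  linear_combination h0 + hu + hv

end Coordinates

/-! ### Transfer of the coordinate identity to the manifolds. -/

section Immersion

variable {E : Type*} [NormedAddCommGroup E] [NormedSpace ℝ E] [FiniteDimensional ℝ E]
  {H : Type*} [TopologicalSpace H] {I : ModelWithCorners ℝ E H} [I.Boundaryless]
  {M : Type*} [TopologicalSpace M] [ChartedSpace H M] [IsManifold I ∞ M]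
  {E' : Type*} [NormedAddCommGroup E'] [NormedSpace ℝ E'] [FiniteDimensional ℝ E']
  {H' : Type*} [TopologicalSpace H'] {I' : ModelWithCorners ℝ E' H'} [I'.Boundaryless]
  {M' : Type*} [TopologicalSpace M'] [ChartedSpace H' M'] [IsManifold I' ∞ M']
  {x : M} {F : M → M'} {g T : FormField I' M'}
  {ι κ : Type*} [Fintype ι] [DecidableEq ι] [Fintype κ] [DecidableEq κ]

omit [FiniteDimensional ℝ E] in
lemma eventually_inChart {P : E → Prop} {q : M} (hq : q ∈ (extChartAt I x).source)
    (h : ∀ᶠ p in 𝓝 q, P (extChartAt I x p)) : ∀ᶠ z in 𝓝 (extChartAt I x q), P z := by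
  have hc : Filter.Tendsto (extChartAt I x).symm (𝓝 (extChartAt I x q)) (𝓝 q) := by
    have := continuousAt_extChartAt_symm'' (I := I) ((extChartAt I x).map_source hq)
    rwa [ContinuousAt, (extChartAt I x).left_inv hq] at this
  filter_upwards [hc.eventually h, eventually_mem_target hq] with z hz hz'
  rwa [(extChartAt I x).right_inv hz'] at hz

/-- The charts stay fixed while `q` varies, so the vanishing of the mean curvature becomes an
identity between functions on an open set that can be differentiated. -/
lemma metricTrace_sffForm_eq_zero (hg : IsMetric g) (hF : ContMDiff I I' ∞ F)
    (hgF : IsMetric (restrictForm I F g)) (hH : HasZeroMeanCurvature I g F) {q : M} {x' : M'}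
    (hq : q ∈ (extChartAt I x).source) (hq' : F q ∈ (extChartAt I' x').source) :
    metricTrace (inChart I x (formCoord I (restrictForm I F g) x) (extChartAt I x q))
      (fun v w ↦ sffForm (chartChristoffel g x') (chartChristoffel (restrictForm I F g) x)
        (mapInChart I I' x x' F) (extChartAt I x q) v w) = 0 := by
  have h := congrArg (toCoord I' x' (F q)).toLinearMap (hH q)
  rw [map_metricTrace, map_zero] at h
  rw [inChart_apply _ hq]
  have hinv := hgF.isInvertible_formCoord hq
  have hsymm : ∀ v w, formCoord I (restrictForm I F g) x q v w =
      formCoord I (restrictForm I F g) x q w v := fun v w ↦ hgF.symm q _ _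
  refine (metricTrace_comp (coordEquiv hq) (apply_eq_formCoord _ hq) hsymm
    (eq_zero_of_isInvertible hsymm hinv) (sffLin _ _ _ _)).symm.trans (Eq.trans ?_ h)
  congr 1
  funext v w
  exact (secondFundamentalForm_coord hg hF hgF hq hq' v w).symm

/-- Bilinearity in the traced arguments is not visible in the definition through extensions; it is
read off from the coordinate expression, after which the trace may be taken in the orthonormal
basis. -/
lemma laplacian_eq_sum {g T : FormField I M} (hg : IsMetric g) (hT : IsSmooth T)
    (e : Module.Basis ι ℝ (TangentSpace I x))
    (he : ∀ k l, g x (e k) (e l) = if k = l then 1 else 0) (a b : TangentSpace I x) :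
    laplacian g T x a b = ∑ l, secondCovDerivForm (chartChristoffel g x)
      (inChart I x (formCoord I T x)) (extChartAt I x x) (toCoord I x x (e l))
      (toCoord I x x (e l)) (toCoord I x x a) (toCoord I x x b) := by
  let B : TangentSpace I x →ₗ[ℝ] TangentSpace I x →ₗ[ℝ] ℝ := LinearMap.mk₂ ℝ
    (fun v w ↦ secondCovDerivForm (chartChristoffel g x)
      (inChart I x (formCoord I T x)) (extChartAt I x x) (toCoord I x x v)
      (toCoord I x x w) (toCoord I x x a) (toCoord I x x b))
    (fun _ _ _ ↦ by simp only [secondCovDerivForm, map_add, add_apply]; ring)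
    (fun _ _ _ ↦ by simp only [secondCovDerivForm, map_smul, smul_apply, smul_eq_mul]; ring)
    (fun _ _ _ ↦ by simp only [secondCovDerivForm, map_add, add_apply]; ring)
    (fun _ _ _ ↦ by simp only [secondCovDerivForm, map_smul, smul_apply, smul_eq_mul]; ring)
  rw [laplacian]
  simp only [secondCovDeriv_coord hg hT]
  exact metricTrace_eq_sum_of_orthonormal (hg.symm x) (hg.nondeg x) e he B

/-- The Laplacian of the restriction of a `(0,2)`-tensor field to a submanifold of zero mean
curvature. -/
theorem laplacian_restrictForm (hg : IsMetric g) (hT : IsSmooth T) (hF : ContMDiff I I' ∞ F)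
    (hgF : IsMetric (restrictForm I F g)) (hH : HasZeroMeanCurvature I g F)
    (b : Module.Basis κ ℝ (TangentSpace I' (F x))) (e : Module.Basis ι ℝ (TangentSpace I x))
    (he : ∀ k l, restrictForm I F g x (e k) (e l) = if k = l then 1 else 0)
    (u v : TangentSpace I x) :
    let D := leviCivita g
    let S := restrictForm I F T
    let A := mfderiv I I' F x
    let B := secondFundamentalForm g F x
    let R := curvature g (F x)
    let σ := (Matrix.of fun i j ↦ g (F x) (b i) (b j))⁻¹
    laplacian (restrictForm I F g) S x u v
      = ∑ l, secondCovDeriv D T (F x) (A (e l)) (A (e l)) (A u) (A v)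
        + 2 * ∑ l, covDeriv D T (F x) (A (e l)) (B (e l) u) (A v)
        + 2 * ∑ l, covDeriv D T (F x) (A (e l)) (A u) (B (e l) v)
        + 2 * ∑ l, T (F x) (B (e l) u) (B (e l) v)
        - ∑ k, ∑ l, g (F x) (B (e l) u) (B (e l) (e k)) * S x (e k) v
        - ∑ k, ∑ l, g (F x) (B (e l) v) (B (e l) (e k)) * S x u (e k)
        - ∑ i, ∑ j, ∑ l, σ i j * R (A (e l)) (A u) (A (e l)) (b i) * T (F x) (b j) (A v)
        - ∑ i, ∑ j, ∑ l, σ i j * R (A (e l)) (A v) (A (e l)) (b i) * T (F x) (A u) (b j)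
        + ∑ k, ∑ l, R (A (e l)) (A u) (A (e l)) (A (e k)) * S x (e k) v
        + ∑ k, ∑ l, R (A (e l)) (A v) (A (e l)) (A (e k)) * S x u (e k) := by
  intro D S A B R σ
  have hx := mem_extChartAt_source (I := I) x
  have hx' := mem_extChartAt_source (I := I') (F x)
  have hFd : ∀ q, MDiffAt F q := fun q ↦ hF.mdifferentiableAt (by simp)
  have hsrc := eventually_mem_source hx
  have hsrc' := eventually_map_mem_source hF.continuous.continuousAt hx'
  have hS : IsSmooth S := isSmooth_restrictForm hT hF
  set f := mapInChart I I' x (F x) F with hf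
  set y := extChartAt I x x with hy
  have hfy : f y = extChartAt I' (F x) (F x) := mapInChart_apply hx
  have hres : ∀ K : FormField I' M', ∀ᶠ z in 𝓝 y, ∀ a b,
      inChart I x (formCoord I (restrictForm I F K) x) z a b =
        inChart I' (F x) (formCoord I' K (F x)) (f z) (fderiv ℝ f z a) (fderiv ℝ f z b) := by
    intro K
    refine eventually_inChart hx ?_
    filter_upwards [hsrc, hsrc'] with q hq hq' a b
    rw [inChart_apply _ hq, formCoord_restrictForm K (hFd q) hq hq', hf, mapInChart_apply hq,
      inChart_apply _ hq']
  have hH' : ∀ᶠ z in 𝓝 y, metricTrace (inChart I x (formCoord I (restrictForm I F g) x) z)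
      (fun v w ↦ sffForm (chartChristoffel g (F x)) (chartChristoffel (restrictForm I F g) x)
        f z v w) = 0 := by
    refine eventually_inChart hx ?_
    filter_upwards [hsrc, hsrc'] with q hq hq'
    exact metricTrace_sffForm_eq_zero hg hF hgF hH hq hq'
  have hg'_symm : ∀ᶠ z in 𝓝 (f y), ∀ v w, inChart I' (F x) (formCoord I' g (F x)) z v w =
      inChart I' (F x) (formCoord I' g (F x)) z w v :=
    Filter.Eventually.of_forall fun z v w ↦ hg.symm _ _ _
  have hg'_inv : ∀ᶠ z in 𝓝 (f y), (inChart I' (F x) (formCoord I' g (F x)) z).IsInvertible := by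
    rw [hfy]
    refine eventually_inChart hx' ?_
    filter_upwards [eventually_mem_source hx'] with q hq
    rw [inChart_apply _ hq]
    exact hg.isInvertible_formCoord hq
  have hg_inv : ∀ᶠ z in 𝓝 y,
      (inChart I x (formCoord I (restrictForm I F g) x) z).IsInvertible := by
    refine eventually_inChart hx ?_
    filter_upwards [hsrc] with q hq
    rw [inChart_apply _ hq]
    exact hgF.isInvertible_formCoord hq
  have hT' : ∀ {K : FormField I' M'}, IsSmooth K →
      ContDiffAt ℝ 2 (inChart I' (F x) (formCoord I' K (F x))) (f y) := by
    intro K hK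
    rw [hfy]
    exact (contDiffAt_formCoord hK hx').of_le ENat.LEInfty.out
  have hform : ∀ (K : FormField I' M') a b, K (F x) a b =
      inChart I' (F x) (formCoord I' K (F x)) (f y) (toCoord I' (F x) (F x) a)
        (toCoord I' (F x) (F x) b) := by
    intro K a b
    rw [hfy, inChart_apply _ hx', apply_eq_formCoord K hx']
  have hA : ∀ a, toCoord I' (F x) (F x) (A a) = fderiv ℝ f y (toCoord I x x a) :=
    toCoord_mfderiv (hFd x) hx hx'
  have hB : ∀ a b, toCoord I' (F x) (F x) (B a b) = sffForm (chartChristoffel g (F x))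
      (chartChristoffel (restrictForm I F g) x) f y (toCoord I x x a) (toCoord I x x b) :=
    secondFundamentalForm_coord hg hF hgF hx hx'
  have hScoord : ∀ a b, S x a b = inChart I' (F x) (formCoord I' T (F x)) (f y)
      (fderiv ℝ f y (toCoord I x x a)) (fderiv ℝ f y (toCoord I x x b)) := by
    intro a b
    rw [← hA, ← hA, ← hform]
    rfl
  have hR : ∀ a b c d, R a b c d = -inChart I' (F x) (formCoord I' g (F x)) (f y)
      (curvatureForm (chartChristoffel g (F x)) (f y) (toCoord I' (F x) (F x) a)
        (toCoord I' (F x) (F x) b) (toCoord I' (F x) (F x) c)) (toCoord I' (F x) (F x) d) := by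
    intro a b c d
    rw [hfy, ← curvatureVector_coord hg, ← hfy, ← hform]
    rfl
  have key := sum_secondCovDerivForm_pullback
    ((contDiffAt_mapInChart hF hx hx').of_le ENat.LEInfty.out) (hT' hg.smooth)
    ((contDiffAt_formCoord hgF.smooth hx).of_le ENat.LEInfty.out) hg'_symm hg'_inv hg_inv (hres g)
    (hT' hT) ((contDiffAt_formCoord hS hx).of_le ENat.LEInfty.out) (hres T) hH'
    (e.map (coordEquiv hx)) (fun k l ↦ by
      rw [← he k l, apply_eq_formCoord _ hx, inChart_apply _ hx]
      rfl)
    (b.map (coordEquiv hx')) (toCoord I x x u) (toCoord I x x v)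
  have hee : ∀ l, e.map (coordEquiv hx) l = toCoord I x x (e l) := fun _ ↦ rfl
  have hbb : ∀ l, b.map (coordEquiv hx') l = toCoord I' (F x) (F x) (b l) := fun _ ↦ rfl
  have h1 := secondCovDeriv_coord (x := F x) hg hT
  have h2 := covDeriv_coord hg hT hx'
  rw [← hfy] at h1 h2
  have hσ : σ = (Matrix.of fun i j ↦ inChart I' (F x) (formCoord I' g (F x)) (f y)
      (toCoord I' (F x) (F x) (b i)) (toCoord I' (F x) (F x) (b j)))⁻¹ := by
    simp only [σ, hform]
  rw [laplacian_eq_sum hgF hS e he, hσ]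
  simp only [hee, hbb] at key
  simp only [D, h1, h2, hR, hScoord, hform, hA, hB]
  exact key

end Immersion

/-! ### Nondegeneracy of the metrics, and the main theorem. -/

lemma IsPseudoRiemannianMetric.isMetric {E : Type*} [NormedAddCommGroup E] [NormedSpace ℝ E]
    {H : Type*} [TopologicalSpace H] {I : ModelWithCorners ℝ E H}
    {M : Type*} [TopologicalSpace M] [ChartedSpace H M] [IsManifold I ∞ M] {n m : ℕ}
    {g : FormField I M} (hg : IsPseudoRiemannianMetric n m g) : IsMetric g where
  smooth := hg.smooth
  symm := hg.symm
  nondeg x v hv := by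
    obtain ⟨b, hb⟩ := hg.signature x
    refine b.ext_elem fun i ↦ ?_
    have h := hv (b i)
    conv at h => lhs; rw [← b.sum_repr v]
    simp only [map_sum, map_smul, hb, smul_eq_mul, mul_ite, mul_zero, Finset.sum_ite_eq,
      Finset.mem_univ, if_true] at h
    rw [map_zero, Finsupp.coe_zero, Pi.zero_apply]
    -- The product of `v` with `b i` is plus or minus its `i`-th coordinate.
    rcases i with i | i <;> simpa using h

lemma IsSpacelikeImmersion.isMetric_restrictForm {E : Type*} [NormedAddCommGroup E]
    [NormedSpace ℝ E] {H : Type*} [TopologicalSpace H] {I : ModelWithCorners ℝ E H}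
    [I.Boundaryless] {M : Type*} [TopologicalSpace M] [ChartedSpace H M] [IsManifold I ∞ M]
    {E' : Type*} [NormedAddCommGroup E'] [NormedSpace ℝ E'] {H' : Type*} [TopologicalSpace H']
    {I' : ModelWithCorners ℝ E' H'} [I'.Boundaryless] {M' : Type*} [TopologicalSpace M']
    [ChartedSpace H' M'] [IsManifold I' ∞ M'] {g : FormField I' M'} {F : M → M'}
    (hF : IsSpacelikeImmersion I g F) (hg : IsMetric g) : IsMetric (restrictForm I F g) where
  smooth := isSmooth_restrictForm hg.smooth hF.contMDiff
  symm x v w := hg.symm _ _ _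
  nondeg x v hv := by
    by_contra h
    -- A nonzero vector in the kernel would have zero product with itself, against positivity.
    exact (hF.pos x v h).ne' (hv v)

lemma linearIndependent_of_orthonormal {V ι : Type*} [AddCommGroup V] [Module ℝ V]
    [TopologicalSpace V] [IsTopologicalAddGroup V] [ContinuousSMul ℝ V] [DecidableEq ι]
    {B : V →L[ℝ] V →L[ℝ] ℝ} {e : ι → V} (he : ∀ k l, B (e k) (e l) = if k = l then 1 else 0) :
    LinearIndependent ℝ e := by
  rw [linearIndependent_iff']
  intro s c hc i hi
  have h := congrArg (B (e i)) hc
  simpa [map_sum, he, hi] using h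

end SpacelikeGeometry

end

open SpacelikeGeometry
theorem proposition2p1 {n m : ℕ}
    {Mhat : Type*} [TopologicalSpace Mhat] [ChartedSpace (EuclideanSpace ℝ (Fin (n + m))) Mhat]
    [IsManifold (𝓡 (n + m)) ∞ Mhat]
    {M : Type*} [TopologicalSpace M] [ChartedSpace (EuclideanSpace ℝ (Fin n)) M]
    [IsManifold (𝓡 n) ∞ M]
    (ghat : FormField (𝓡 (n + m)) Mhat) (hghat : IsPseudoRiemannianMetric n m ghat)
    (Shat : FormField (𝓡 (n + m)) Mhat) (hShat : IsSmooth Shat)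
    (hShat_symm : ∀ x v w, Shat x v w = Shat x w v)
    (F : M → Mhat) (hF : IsSpacelikeImmersion (𝓡 n) ghat F)
    (hH : HasZeroMeanCurvature (𝓡 n) ghat F)
    (p : M)
    (Ehat : Module.Basis (Fin (n + m)) ℝ (TangentSpace (𝓡 (n + m)) (F p)))
    (e : Fin n → TangentSpace (𝓡 n) p)
    (he : ∀ k l, restrictForm (𝓡 n) F ghat p (e k) (e l) = if k = l then 1 else 0)
    (X Y : TangentSpace (𝓡 n) p) :
    let Dhat := leviCivita ghat
    let S := restrictForm (𝓡 n) F Shat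
    let ι := mfderiv (𝓡 n) (𝓡 (n + m)) F p
    let II := secondFundamentalForm ghat F p
    let R := curvature ghat (F p)
    let σ := (Matrix.of fun α β ↦ ghat (F p) (Ehat α) (Ehat β))⁻¹
    laplacian (restrictForm (𝓡 n) F ghat) S p X Y
      = ∑ l, secondCovDeriv Dhat Shat (F p) (ι (e l)) (ι (e l)) (ι X) (ι Y)
        + 2 * ∑ l, covDeriv Dhat Shat (F p) (ι (e l)) (II (e l) X) (ι Y)
        + 2 * ∑ l, covDeriv Dhat Shat (F p) (ι (e l)) (ι X) (II (e l) Y)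
        + 2 * ∑ l, Shat (F p) (II (e l) X) (II (e l) Y)
        - ∑ k, ∑ l, ghat (F p) (II (e l) X) (II (e l) (e k)) * S p (e k) Y
        - ∑ k, ∑ l, ghat (F p) (II (e l) Y) (II (e l) (e k)) * S p X (e k)
        - ∑ α, ∑ β, ∑ l, σ α β * R (ι (e l)) (ι X) (ι (e l)) (Ehat α) * Shat (F p) (Ehat β) (ι Y)
        - ∑ α, ∑ β, ∑ l, σ α β * R (ι (e l)) (ι Y) (ι (e l)) (Ehat α) * Shat (F p) (ι X) (Ehat β)
        + ∑ k, ∑ l, R (ι (e l)) (ι X) (ι (e l)) (ι (e k)) * S p (e k) Y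
        + ∑ k, ∑ l, R (ι (e l)) (ι Y) (ι (e l)) (ι (e k)) * S p X (e k) := by
  have hg := hghat.isMetric
  have hcard : Fintype.card (Fin n) = Module.finrank ℝ (TangentSpace (𝓡 n) p) := by
    rw [Fintype.card_fin]
    exact finrank_euclideanSpace_fin.symm
  -- Orthonormality makes the `n` vectors independent, hence a basis of the `n`-dimensional tangent
  -- space.
  let c := basisOfLinearIndependentOfCardEqFinrank' e (linearIndependent_of_orthonormal he) hcard
  have hc : ⇑c = e := coe_basisOfLinearIndependentOfCardEqFinrank' _ _ _
  have key := laplacian_restrictForm hg hShat hF.contMDiff (hF.isMetric_restrictForm hg) hH Ehat c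
    (by rwa [hc]) X Y
  rw [hc] at key
  exact key
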